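/- Let $(V,g)$ be a smooth pseudo-Riemannian manifold of dimension $N>3$ with Levi-Civita connection $\nabla$. A smooth foliation of $V$ of codimension $p$ is a family $\{\Sigma_\tau\}_{\tau\in I}$, $I\subset\mathbb R^p$, of pairwise disjoint embedded submanifolds of dimension $N-p$ (the leaves) which cover $V$ and whose tangent spaces form a smooth distribution; it is non-degenerate if the metric induced by $g$ on each leaf is everywhere non-degenerate. Let such a non-degenerate foliation be given, with $N-p\ge 3$, and let $(P,\Pi)$ be the associated pair of complementary orthogonal projectors: $P_{ab},\Pi_{ab}$ are smooth and symmetric with $$P_{ab}P^b{}_c=P_{ac},\quad \Pi_{ab}\Pi^b{}_c=\Pi_{ac},\quad P_{ab}\Pi^b{}_c=0,\quad P_{ab}+\Pi_{ab}=g_{ab},$$ and $\Pi_x(T_xV)=T_x\Sigma_\tau$ for $x\in\Sigma_\tau$. Put $$M_{abc}=\nabla_bP_{ac}+\nabla_cP_{ab}-\nabla_aP_{bc},\qquad E_a=M_{acb}P^{cb},\qquad W_a=-M_{acb}\Pi^{cb},$$ $$L^a{}_{bc}=\frac{1}{2\,\mathrm{tr}P}\left(E_bP^a{}_c+E_cP^a{}_b\right)+\frac{1}{2(N-\mathrm{tr}P)}\left(W_b\Pi^a{}_c+W_c\Pi^a{}_b\right)+\frac12\left(P^a{}_d-\Pi^a{}_d\right)M^d{}_{bc}$$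 (if $p=0$, so that $P=0$, the first term is read as $0$). The bi-conformal connection is $(\bar\nabla_XY)^a=(\nabla_XY)^a+L^a{}_{bc}X^bY^c$; let $\bar R_{abc}{}^d$ be its curvature tensor, with the convention $$\bar R_{abc}{}^dX^aY^bZ^c=\left(\bar\nabla_Y\bar\nabla_XZ-\bar\nabla_X\bar\nabla_YZ-\bar\nabla_{[Y,X]}Z\right)^d .$$ Then the projected curvature tensor $$(\bar R^{||}(\Pi))_{cab}{}^d=\Pi^d{}_r\,\Pi^s{}_c\,\Pi^t{}_a\,\Pi^q{}_b\,\bar R_{stq}{}^r$$ vanishes on $V$ if and only if every leaf is flat, i.e. the Riemann curvature tensor of the metric induced by $g$ on every leaf vanishes. -/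

import Mathlib

open scoped Manifold ContDiff Topology
open Bundle VectorField

namespace BiConformal

set_option linter.unusedSectionVars false

noncomputable section

section Metric

variable (E : Type*) [NormedAddCommGroup E] [NormedSpace ℝ E] [FiniteDimensional ℝ E]
  (M : Type*) [TopologicalSpace M] [ChartedSpace E M] [IsManifold 𝓘(ℝ, E) ∞ M]

/-- A smooth symmetric covariant 2-tensor field `x ↦ B_x` on the manifold `M` modelled on `E`. -/
structure SmoothBilinearForm where
  form (x : M) : TangentSpace 𝓘(ℝ, E) x →L[ℝ] TangentSpace 𝓘(ℝ, E) x →L[ℝ] ℝ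
  symm (x : M) (u v : TangentSpace 𝓘(ℝ, E) x) : form x u v = form x v u
  contMDiff : ContMDiff 𝓘(ℝ, E) (𝓘(ℝ, E).prod 𝓘(ℝ, E →L[ℝ] E →L[ℝ] ℝ)) ∞
    (fun x => TotalSpace.mk' (E →L[ℝ] E →L[ℝ] ℝ)
      (E := fun x : M => TangentSpace 𝓘(ℝ, E) x →L[ℝ] TangentSpace 𝓘(ℝ, E) x →L[ℝ] ℝ) x (form x))

/-- A smooth pseudo-Riemannian metric (of arbitrary signature): a smooth symmetric covariant
2-tensor field which is non-degenerate at each point. -/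
structure PseudoRiemannianMetric extends SmoothBilinearForm E M where
  nondegenerate (x : M) (u : TangentSpace 𝓘(ℝ, E) x) (hu : ∀ v, form x u v = 0) : u = 0

end Metric

variable {E : Type*} [NormedAddCommGroup E] [NormedSpace ℝ E] [FiniteDimensional ℝ E]
  {M : Type*} [TopologicalSpace M] [ChartedSpace E M] [IsManifold 𝓘(ℝ, E) ∞ M]

lemma SmoothBilinearForm.mdiffAt (B : SmoothBilinearForm E M) {X Y : Π x : M, TangentSpace 𝓘(ℝ, E) x} {x : M} 
   (hX : MDiffAt (T% X) x) (hY : MDiffAt (T% Y) x) : MDiffAt (fun y => B.form y (X y) (Y y)) x := by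
  have h : MDifferentiableAt 𝓘(ℝ, E) (𝓘(ℝ, E).prod 𝓘(ℝ, ℝ)) (fun y => TotalSpace.mk' ℝ (E := Bundle.Trivial M ℝ) y (B.form y (X y) (Y y))) x := by
    apply MDifferentiableAt.clm_bundle_apply₂ (F₁ := E) (F₂ := E)
    · exact (B.contMDiff.contMDiffAt (x := x)).mdifferentiableAt (by simp)
    · exact hX
    · exact hY
  rw [mdifferentiableAt_totalSpace] at h
  simpa using h.2

namespace SmoothBilinearForm
variable (B : SmoothBilinearForm E M) {x : M}

lemma mvfderiv_smul_left {f : M → ℝ} {X Y : Π x : M, TangentSpace 𝓘(ℝ, E) x}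
    (hf : MDiffAt f x) (hX : MDiffAt (T% X) x) (hY : MDiffAt (T% Y) x) :
    d% (fun y => B.form y ((f • X) y) (Y y)) x =
      f x • d% (fun y => B.form y (X y) (Y y)) x + B.form x (X x) (Y x) • d% f x := by
  have := mvfderiv_mul hf (B.mdiffAt hX hY)
  rw [← this]; congr 1; ext y; simp

lemma mvfderiv_smul_right {f : M → ℝ} {X Y : Π x : M, TangentSpace 𝓘(ℝ, E) x}
    (hf : MDiffAt f x) (hX : MDiffAt (T% X) x) (hY : MDiffAt (T% Y) x) :
    d% (fun y => B.form y (X y) ((f • Y) y)) x =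
      f x • d% (fun y => B.form y (X y) (Y y)) x + B.form x (X x) (Y x) • d% f x := by
  have := mvfderiv_mul hf (B.mdiffAt hX hY)
  rw [← this]; congr 1; ext y; simp

lemma mvfderiv_add_left {X X' Y : Π x : M, TangentSpace 𝓘(ℝ, E) x}
    (hX : MDiffAt (T% X) x) (hX' : MDiffAt (T% X') x) (hY : MDiffAt (T% Y) x) :
    d% (fun y => B.form y ((X + X') y) (Y y)) x =
      d% (fun y => B.form y (X y) (Y y)) x + d% (fun y => B.form y (X' y) (Y y)) x := by
  have := mvfderiv_add (B.mdiffAt hX hY) (B.mdiffAt hX' hY)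
  rw [← this]; congr 1; ext y; simp

lemma mvfderiv_add_right {X Y Y' : Π x : M, TangentSpace 𝓘(ℝ, E) x}
    (hX : MDiffAt (T% X) x) (hY : MDiffAt (T% Y) x) (hY' : MDiffAt (T% Y') x) :
    d% (fun y => B.form y (X y) ((Y + Y') y)) x =
      d% (fun y => B.form y (X y) (Y y)) x + d% (fun y => B.form y (X y) (Y' y)) x := by
  have := mvfderiv_add (B.mdiffAt hX hY) (B.mdiffAt hX hY')
  rw [← this]; congr 1; ext y; simp

end SmoothBilinearForm

instance (x : M) : FiniteDimensional ℝ (TangentSpace 𝓘(ℝ, E) x) := inferInstanceAs (FiniteDimensional ℝ E)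
instance (x : M) : T2Space (TangentSpace 𝓘(ℝ, E) x) := inferInstanceAs (T2Space E)

/-- Raising an index with the metric: `g.sharp x φ` is the vector `v` with `g(v, w) = φ w` for all
`w`, see `form_sharp`. -/
def PseudoRiemannianMetric.sharp (g : PseudoRiemannianMetric E M) (x : M) :
   (TangentSpace 𝓘(ℝ, E) x →L[ℝ] ℝ) ≃ₗ[ℝ] TangentSpace 𝓘(ℝ, E) x :=
  (LinearMap.linearEquivOfInjective (g.form x).toLinearMap
    ((injective_iff_map_eq_zero _).2 fun u hu => g.nondegenerate x u fun v => by
      simpa using DFunLike.congr_fun hu v)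
    (by
      rw [← LinearMap.toContinuousLinearMap.finrank_eq]
      exact (Subspace.dual_finrank_eq (K := ℝ) (V := TangentSpace 𝓘(ℝ, E) x)).symm)).symm

lemma PseudoRiemannianMetric.form_sharp (g : PseudoRiemannianMetric E M) (x : M) (φ : TangentSpace 𝓘(ℝ, E) x →L[ℝ] ℝ) (v) :
  g.form x (g.sharp x φ) v = φ v := 
  DFunLike.congr_fun ((g.sharp x).symm_apply_apply φ) v

/-- The right-hand side of Koszul's formula for `2 g(∇_X Y, Z)`. -/
def PseudoRiemannianMetric.koszul (g : PseudoRiemannianMetric E M) (X Y Z : Π x : M, TangentSpace 𝓘(ℝ, E) x) (x : M) : ℝ :=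
   d% (fun y => g.form y (Y y) (Z y)) x (X x)
   + d% (fun y => g.form y (X y) (Z y)) x (Y x)
   - d% (fun y => g.form y (X y) (Y y)) x (Z x)
   + g.form x (mlieBracket 𝓘(ℝ, E) X Y x) (Z x)
   - g.form x (mlieBracket 𝓘(ℝ, E) X Z x) (Y x)
   - g.form x (mlieBracket 𝓘(ℝ, E) Y Z x) (X x)
namespace PseudoRiemannianMetric

variable (g : PseudoRiemannianMetric E M) {x : M}

lemma koszul_tensorial_left {Y Z : Π x : M, TangentSpace 𝓘(ℝ, E) x}
    (hY : MDiffAt (T% Y) x) (hZ : MDiffAt (T% Z) x) :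
    TensorialAt 𝓘(ℝ, E) E (fun X => g.koszul X Y Z x) x where
  smul hf hX := by
    simp only [koszul, g.mvfderiv_smul_left hf hX hY, g.mvfderiv_smul_left hf hX hZ,
      mlieBracket_smul_left hf hX]
    simp
    ring
  add hX hX' := by
    simp only [koszul, g.mvfderiv_add_left hX hX' hY, g.mvfderiv_add_left hX hX' hZ,
      mlieBracket_add_left hX hX']
    simp
    ring

lemma koszul_tensorial_right {X Y : Π x : M, TangentSpace 𝓘(ℝ, E) x}
    (hX : MDiffAt (T% X) x) (hY : MDiffAt (T% Y) x) :
    TensorialAt 𝓘(ℝ, E) E (fun Z => g.koszul X Y Z x) x where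
  smul hf hZ := by
    simp only [koszul, g.mvfderiv_smul_right hf hX hZ, g.mvfderiv_smul_right hf hY hZ,
      mlieBracket_smul_right hf hZ]
    simp [g.symm x _ (X x), g.symm x _ (Y x)]
    ring
  add hZ hZ' := by
    simp only [koszul, g.mvfderiv_add_right hX hZ hZ', g.mvfderiv_add_right hY hZ hZ',
      mlieBracket_add_right hZ hZ']
    simp
    ring

open Classical in
/-- `∇Y` at `x`: the endomorphism with `2 g(∇_u Y, Z) = koszul(u, Y, Z)`. As for every Mathlib
covariant derivative the value on a field not differentiable at `x` is irrelevant (here `0`). -/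
def leviCivitaAux (Y : Π x : M, TangentSpace 𝓘(ℝ, E) x) (x : M) :
    TangentSpace 𝓘(ℝ, E) x →L[ℝ] TangentSpace 𝓘(ℝ, E) x :=
  if hY : MDiffAt (T% Y) x then
    (1 / 2 : ℝ) • LinearMap.toContinuousLinearMap ((g.sharp x).toLinearMap ∘ₗ
      (TensorialAt.mkHom₂ (fun X Z => g.koszul X Y Z x) x
        (fun _ hZ => g.koszul_tensorial_left hY hZ)
        (fun _ hX => g.koszul_tensorial_right hX hY)).toLinearMap)
  else 0

lemma form_leviCivitaAux {X Y Z : Π x : M, TangentSpace 𝓘(ℝ, E) x}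
    (hX : MDiffAt (T% X) x) (hY : MDiffAt (T% Y) x) (hZ : MDiffAt (T% Z) x) :
    2 * g.form x (g.leviCivitaAux Y x (X x)) (Z x) = g.koszul X Y Z x := by
  simp only [leviCivitaAux, hY, dif_pos]
  simp [form_sharp]
  exact TensorialAt.mkHom₂_apply (Φ := fun X Z => g.koszul X Y Z x) (fun _ hZ => g.koszul_tensorial_left hY hZ)
        (fun _ hX => g.koszul_tensorial_right hX hY) hX hZ

lemma ext_form {u v : TangentSpace 𝓘(ℝ, E) x} (h : ∀ w, g.form x u w = g.form x v w) : u = v := by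
  rw [← sub_eq_zero]
  refine g.nondegenerate x _ fun w => ?_
  simp [h]

lemma ext_koszul {u v : TangentSpace 𝓘(ℝ, E) x} 
   (h : ∀ Z : Π x : M, TangentSpace 𝓘(ℝ, E) x, MDiffAt (T% Z) x → g.form x u (Z x) = g.form x v (Z x)) : u = v := by
  refine g.ext_form fun w => ?_
  simpa using h (FiberBundle.extend E w) (FiberBundle.mdifferentiableAt_extend ..)

/-- The Levi-Civita connection of a pseudo-Riemannian metric, given by Koszul's formula.
Mathlib's convention: `g.leviCivita Y x u` is `(∇_u Y)(x)`. -/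
def leviCivita : CovariantDerivative 𝓘(ℝ, E) E (TangentSpace 𝓘(ℝ, E) : M → Type _) where
  toFun := g.leviCivitaAux
  isCovariantDerivativeOnUniv := {
    add := fun {Y Y' x} hY hY' _ => by
      ext u
      refine g.ext_koszul fun Z hZ => ?_
      have hX := FiberBundle.mdifferentiableAt_extend 𝓘(ℝ, E) E u
      have h := g.form_leviCivitaAux hX hY hZ
      have h' := g.form_leviCivitaAux hX hY' hZ
      have h'' := g.form_leviCivitaAux hX (mdifferentiableAt_add_section hY hY') hZ
      simp only [FiberBundle.extend_apply_self] at h h' h''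
      rw [← mul_right_inj' (two_ne_zero' ℝ)]
      simp only [add_apply, map_add, mul_add, h, h']
      refine h''.trans ?_
      simp only [koszul, g.mvfderiv_add_left hY hY' hZ, g.mvfderiv_add_right hX hY hY',
        mlieBracket_add_right hY hY', mlieBracket_add_left hY hY']
      simp
      ring
    leibniz := fun {Y f x} hY hf _ => by
      ext u
      refine g.ext_koszul fun Z hZ => ?_
      have hX := FiberBundle.mdifferentiableAt_extend 𝓘(ℝ, E) E u
      have h := g.form_leviCivitaAux hX hY hZ
      have h'' := g.form_leviCivitaAux hX (hf.smul_section hY) hZ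
      simp only [FiberBundle.extend_apply_self] at h h''
      rw [← mul_right_inj' (two_ne_zero' ℝ)]
      refine h''.trans ?_
      simp only [koszul, g.mvfderiv_smul_left hf hY hZ, g.mvfderiv_smul_right hf hX hY,
        mlieBracket_smul_right hf hY, mlieBracket_smul_left hf hY] at h ⊢
      simp [g.symm x u (Y x)] at h ⊢
      linear_combination -(f x) * h }

lemma form_leviCivita {X Y Z : Π x : M, TangentSpace 𝓘(ℝ, E) x}
    (hX : MDiffAt (T% X) x) (hY : MDiffAt (T% Y) x) (hZ : MDiffAt (T% Z) x) :
    2 * g.form x (g.leviCivita Y x (X x)) (Z x) = g.koszul X Y Z x := g.form_leviCivitaAux hX hY hZ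

/-- The Levi-Civita connection is torsion-free. -/
lemma leviCivita_torsion : g.leviCivita.torsion = 0 := by
  rw [CovariantDerivative.torsion_eq_zero_iff]
  intro X Y x hX hY 
  refine g.ext_koszul fun Z hZ => ?_
  have h1 := g.form_leviCivita hX hY hZ
  have h2 := g.form_leviCivita hY hX hZ
  rw [← mul_right_inj' (two_ne_zero' ℝ)]
  simp only [map_sub, sub_apply, mul_sub, h1, h2]
  simp only [koszul, g.symm _ (Y _) (X _), mlieBracket_swap_apply (V := Y) (W := X)]
  simp
  ring

/-- The Levi-Civita connection is compatible with the metric. -/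
lemma leviCivita_metric {X Y Z : Π x : M, TangentSpace 𝓘(ℝ, E) x}
    (hX : MDiffAt (T% X) x) (hY : MDiffAt (T% Y) x) (hZ : MDiffAt (T% Z) x) :
    d% (fun y => g.form y (Y y) (Z y)) x (X x) =
      g.form x (g.leviCivita Y x (X x)) (Z x) + g.form x (Y x) (g.leviCivita Z x (X x)) := by
  have h1 := g.form_leviCivita hX hY hZ
  have h2 := g.form_leviCivita hX hZ hY
  rw [← mul_right_inj' (two_ne_zero' ℝ), mul_add, g.symm _ (Y x), h1, h2]
  simp only [koszul, g.symm _ (Z _) (Y _), mlieBracket_swap_apply (V := Z) (W := Y)]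
  simp
  ring

end PseudoRiemannianMetric

section pullback
variable {E' : Type*} [NormedAddCommGroup E'] [NormedSpace ℝ E'] [FiniteDimensional ℝ E']
  {L : Type*} [TopologicalSpace L] [ChartedSpace E' L] [IsManifold 𝓘(ℝ, E') ∞ L]

namespace SmoothBilinearForm

/-- The pull-back `f^* B`: `(u, v) ↦ B(df u, df v)`. -/
def pullbackForm (B : SmoothBilinearForm E M) (f : L → M) (y : L) :
    TangentSpace 𝓘(ℝ, E') y →L[ℝ] TangentSpace 𝓘(ℝ, E') y →L[ℝ] ℝ :=
  LinearMap.toContinuousBilinearMap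
    (LinearMap.mk₂ ℝ
      (fun u v => B.form (f y) (mfderiv 𝓘(ℝ, E') 𝓘(ℝ, E) f y u) (mfderiv 𝓘(ℝ, E') 𝓘(ℝ, E) f y v))
      (by simp) (by simp) (by simp) (by simp))

lemma contMDiff_pullbackForm (B : SmoothBilinearForm E M) {f : L → M}
    (hf : ContMDiff 𝓘(ℝ, E') 𝓘(ℝ, E) ∞ f) :
    ContMDiff 𝓘(ℝ, E') (𝓘(ℝ, E').prod 𝓘(ℝ, E' →L[ℝ] E' →L[ℝ] ℝ)) ∞
      (fun y => TotalSpace.mk' (E' →L[ℝ] E' →L[ℝ] ℝ)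
        (E := fun y : L => TangentSpace 𝓘(ℝ, E') y →L[ℝ] TangentSpace 𝓘(ℝ, E') y →L[ℝ] ℝ) y
        (B.pullbackForm f y)) := by
  intro y₀
  rw [contMDiffAt_hom_bundle]
  refine ⟨contMDiffAt_id, ?_⟩
  have hg := (B.contMDiff.comp hf) y₀
  rw [Function.comp_def] at hg
  rw [contMDiffAt_hom_bundle] at hg
  have hg' := hg.2
  have hA := ContMDiffAt.mfderiv_const (m := ∞) (hf y₀) (by simp)
  have hcomp : ContDiff ℝ ∞ (fun p : (E →L[ℝ] E →L[ℝ] ℝ) × (E' →L[ℝ] E) => p.1.bilinearComp p.2 p.2) := by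
    have h : (fun p : (E →L[ℝ] E →L[ℝ] ℝ) × (E' →L[ℝ] E) => p.1.bilinearComp p.2 p.2) =
        fun p => ((ContinuousLinearMap.compL ℝ E' E ℝ).flip p.2).comp (p.1.comp p.2) := by
      ext p u v
      simp
    rw [h]
    fun_prop
  refine (hcomp.contMDiff.contMDiffAt.comp y₀ (hg'.prodMk_space hA)).congr_of_eventuallyEq ?_
  have A : ∀ᶠ y in 𝓝 y₀, y ∈ (trivializationAt E' (TangentSpace 𝓘(ℝ, E')) y₀).baseSet :=
    (trivializationAt E' (TangentSpace 𝓘(ℝ, E')) y₀).open_baseSet.mem_nhds (FiberBundle.mem_baseSet_trivializationAt' y₀)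
  have A' : ∀ᶠ y in 𝓝 y₀, f y ∈ (trivializationAt E (TangentSpace 𝓘(ℝ, E)) (f y₀)).baseSet :=
    (hf y₀).continuousAt ((trivializationAt E (TangentSpace 𝓘(ℝ, E)) (f y₀)).open_baseSet.mem_nhds (FiberBundle.mem_baseSet_trivializationAt' _))
  filter_upwards [A, A'] with y hy hy'
  ext u v
  simp only [Function.comp_apply, ContinuousLinearMap.bilinearComp_apply]
  rw [inCoordinates_apply_eq₂ hy hy (Set.mem_univ _)]
  rw [inCoordinates_apply_eq₂ hy' hy' (Set.mem_univ _)]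
  simp only [inTangentCoordinates, id_eq]
  rw [ContinuousLinearMap.inCoordinates_eq hy hy']
  have key : ∀ w : TangentSpace 𝓘(ℝ, E) (f y),
      (trivializationAt E (TangentSpace 𝓘(ℝ, E)) (f y₀)).symm (f y)
        ((trivializationAt E (TangentSpace 𝓘(ℝ, E)) (f y₀)) ⟨f y, w⟩).2 = w :=
    fun w => Trivialization.symm_apply_apply_mk _ hy' w
  simp [pullbackForm]
  erw [key, key]

end SmoothBilinearForm

/-- The pull-back `f^* g` of a metric along a smooth map for which it is non-degenerate. For the
inclusion of a submanifold this is the induced metric (first fundamental form). -/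
def PseudoRiemannianMetric.pullback (g : PseudoRiemannianMetric E M) (f : L → M)
    (hf : ContMDiff 𝓘(ℝ, E') 𝓘(ℝ, E) ∞ f)
    (hnd : ∀ (y : L) (u : TangentSpace 𝓘(ℝ, E') y),
      (∀ v, g.form (f y) (mfderiv 𝓘(ℝ, E') 𝓘(ℝ, E) f y u)
        (mfderiv 𝓘(ℝ, E') 𝓘(ℝ, E) f y v) = 0) → u = 0) :
    PseudoRiemannianMetric E' L where
  form := g.pullbackForm f
  symm y _ _ := g.symm (f y) _ _
  contMDiff := g.contMDiff_pullbackForm hf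
  nondegenerate y u hu := hnd y u hu

end pullback

section Tensors

namespace SmoothBilinearForm
variable (B : SmoothBilinearForm E M)
  (cov : CovariantDerivative 𝓘(ℝ, E) E (TangentSpace 𝓘(ℝ, E) : M → Type _))

/-- `u ↦ u(B(Y, Z)) - B(∇_u Y, Z) - B(Y, ∇_u Z)` at the point `x`. -/
def covDerivAux (Y Z : Π x : M, TangentSpace 𝓘(ℝ, E) x) (x : M) :
    TangentSpace 𝓘(ℝ, E) x →L[ℝ] ℝ :=
  d% (fun y => B.form y (Y y) (Z y)) x - (B.form x (Z x)).comp (cov Y x)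
    - (B.form x (Y x)).comp (cov Z x)

lemma covDerivAux_tensorial_left {x : M} {Z : Π x : M, TangentSpace 𝓘(ℝ, E) x} (hZ : MDiffAt (T% Z) x) :
    TensorialAt 𝓘(ℝ, E) E (fun Y => B.covDerivAux cov Y Z x) x where
  smul hf hY := by
    ext u
    simp only [covDerivAux, B.mvfderiv_smul_left hf hY hZ, cov.isCovariantDerivativeOnUniv.leibniz hY hf]
    simp [B.symm x (Z x)]
    ring
  add hY hY' := by
    ext u
    simp only [covDerivAux, B.mvfderiv_add_left hY hY' hZ, cov.isCovariantDerivativeOnUniv.add hY hY']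
    simp
    ring

lemma covDerivAux_tensorial_right {x : M} {Y : Π x : M, TangentSpace 𝓘(ℝ, E) x} (hY : MDiffAt (T% Y) x) :
    TensorialAt 𝓘(ℝ, E) E (fun Z => B.covDerivAux cov Y Z x) x where
  smul hf hZ := by
    ext u
    simp only [covDerivAux, B.mvfderiv_smul_right hf hY hZ, cov.isCovariantDerivativeOnUniv.leibniz hZ hf]
    simp
    ring
  add hZ hZ' := by
    ext u
    simp only [covDerivAux, B.mvfderiv_add_right hY hZ hZ', cov.isCovariantDerivativeOnUniv.add hZ hZ']
    simp
    ring

/-- The covariant derivative `∇B` of a 2-tensor field: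
`B.covDeriv cov x v w u = (∇_u B)(v, w)`; the direction of differentiation is the last slot. -/
def covDeriv (x : M) : TangentSpace 𝓘(ℝ, E) x →L[ℝ] TangentSpace 𝓘(ℝ, E) x →L[ℝ]
    TangentSpace 𝓘(ℝ, E) x →L[ℝ] ℝ :=
  TensorialAt.mkHom₂ (fun Y Z => B.covDerivAux cov Y Z x) x
    (fun _ hZ => B.covDerivAux_tensorial_left cov hZ)
    (fun _ hY => B.covDerivAux_tensorial_right cov hY)

end SmoothBilinearForm

/-- Curvature of a linear connection on vector fields, with the sign convention
`R(X, Y) Z = ∇_Y ∇_X Z - ∇_X ∇_Y Z - ∇_[Y, X] Z`. -/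
def curvatureField (cov : CovariantDerivative 𝓘(ℝ, E) E (TangentSpace 𝓘(ℝ, E) : M → Type _))
    (X Y Z : Π x : M, TangentSpace 𝓘(ℝ, E) x) (x : M) : TangentSpace 𝓘(ℝ, E) x :=
  cov (fun y => cov Z y (X y)) x (Y x) - cov (fun y => cov Z y (Y y)) x (X x)
    - cov Z x (mlieBracket 𝓘(ℝ, E) Y X x)

/-- The curvature tensor `R_{abc}^d u^a v^b w^c` at a point, computed on the extensions of `u, v, w`
to vector fields with constant components in the trivialization of `TM` at `x` (smooth near `x`). -/
def curvature (cov : CovariantDerivative 𝓘(ℝ, E) E (TangentSpace 𝓘(ℝ, E) : M → Type _))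
    (x : M) (u v w : TangentSpace 𝓘(ℝ, E) x) : TangentSpace 𝓘(ℝ, E) x :=
  curvatureField cov (FiberBundle.extend E u) (FiberBundle.extend E v) (FiberBundle.extend E w) x

/-- A pseudo-Riemannian manifold is flat if the Riemann tensor of its metric vanishes. -/
def PseudoRiemannianMetric.IsFlat (g : PseudoRiemannianMetric E M) : Prop :=
  ∀ (x : M) (u v w : TangentSpace 𝓘(ℝ, E) x), curvature g.leviCivita x u v w = 0

/-- Raising the first index of a 2-tensor: the endomorphism `B^a_b`, with `g(B v, w) = B(v, w)`. -/
def PseudoRiemannianMetric.raise (g : PseudoRiemannianMetric E M) (B : SmoothBilinearForm E M)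
    (x : M) : TangentSpace 𝓘(ℝ, E) x →ₗ[ℝ] TangentSpace 𝓘(ℝ, E) x :=
  (g.sharp x).toLinearMap ∘ₗ (B.form x).toLinearMap

/-- A pair of complementary orthogonal projectors: smooth symmetric tensor fields `P_ab`, `Π_ab` with
`P_ab P^b_c = P_ac`, `Π_ab Π^b_c = Π_ac`, `P_ab Π^b_c = 0`, `P_ab + Π_ab = g_ab`. -/
structure ProjectorPair (g : PseudoRiemannianMetric E M) where
  P : SmoothBilinearForm E M
  Pi : SmoothBilinearForm E M
  P_P (x : M) (u v : TangentSpace 𝓘(ℝ, E) x) : P.form x u (g.raise P x v) = P.form x u v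
  Pi_Pi (x : M) (u v : TangentSpace 𝓘(ℝ, E) x) : Pi.form x u (g.raise Pi x v) = Pi.form x u v
  P_Pi (x : M) (u v : TangentSpace 𝓘(ℝ, E) x) : P.form x u (g.raise Pi x v) = 0
  P_add_Pi (x : M) (u v : TangentSpace 𝓘(ℝ, E) x) : P.form x u v + Pi.form x u v = g.form x u v

namespace ProjectorPair
variable {g : PseudoRiemannianMetric E M} (Q : ProjectorPair g)

/-- The projection morphism `P^a_b`. -/
def projP (x : M) : TangentSpace 𝓘(ℝ, E) x →ₗ[ℝ] TangentSpace 𝓘(ℝ, E) x := g.raise Q.P x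

/-- The projection morphism `Π^a_b`. -/
def projPi (x : M) : TangentSpace 𝓘(ℝ, E) x →ₗ[ℝ] TangentSpace 𝓘(ℝ, E) x := g.raise Q.Pi x

set_option synthInstance.maxHeartbeats 200000 in
/-- `M_abc = ∇_b P_ac + ∇_c P_ab - ∇_a P_bc`, with `∇` the Levi-Civita connection. -/
def tensorM (x : M) : TangentSpace 𝓘(ℝ, E) x →ₗ[ℝ] TangentSpace 𝓘(ℝ, E) x →ₗ[ℝ]
    TangentSpace 𝓘(ℝ, E) x →ₗ[ℝ] ℝ :=
  LinearMap.mk₂ ℝ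
    (fun a b =>
      { toFun := fun c => Q.P.covDeriv g.leviCivita x a c b + Q.P.covDeriv g.leviCivita x a b c
          - Q.P.covDeriv g.leviCivita x b c a
        map_add' := fun c c' => by simp; ring
        map_smul' := fun r c => by simp; ring })
    (fun a a' b => by ext c; simp; ring)
    (fun r a b => by ext c; simp; ring)
    (fun a b b' => by ext c; simp; ring)
    (fun r a b => by ext c; simp; ring)



/-- `E_a = M_acb P^cb`, as the trace of the endomorphism `M_acb g^bd P^e_d` (indices `c`, `e`). -/
def covectorE (x : M) : TangentSpace 𝓘(ℝ, E) x →ₗ[ℝ] ℝ where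
  toFun a := LinearMap.trace ℝ (TangentSpace 𝓘(ℝ, E) x)
    (Q.projP x ∘ₗ (g.sharp x).toLinearMap ∘ₗ
      LinearMap.toContinuousLinearMap.toLinearMap ∘ₗ Q.tensorM x a)
  map_add' a a' := by
    simp only [map_add, LinearMap.comp_add]
  map_smul' r a := by
    simp only [map_smul, LinearMap.comp_smul, RingHom.id_apply]

/-- `W_a = -M_acb Π^cb`. -/
def covectorW (x : M) : TangentSpace 𝓘(ℝ, E) x →ₗ[ℝ] ℝ where
  toFun a := -LinearMap.trace ℝ (TangentSpace 𝓘(ℝ, E) x)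
    (Q.projPi x ∘ₗ (g.sharp x).toLinearMap ∘ₗ
      LinearMap.toContinuousLinearMap.toLinearMap ∘ₗ Q.tensorM x a)
  map_add' a a' := by
    simp only [map_add, LinearMap.comp_add, neg_add]
  map_smul' r a := by
    simp only [map_smul, LinearMap.comp_smul, RingHom.id_apply, smul_neg]

/-- `M^a_bc`, the first index of `M` raised with the metric. -/
def raisedM (x : M) (b c : TangentSpace 𝓘(ℝ, E) x) : TangentSpace 𝓘(ℝ, E) x :=
  g.sharp x (LinearMap.toContinuousLinearMap (((Q.tensorM x).flip b).flip c))

lemma raisedM_add_left (x : M) (b b' c : TangentSpace 𝓘(ℝ, E) x) :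
    Q.raisedM x (b + b') c = Q.raisedM x b c + Q.raisedM x b' c := by
  simp only [raisedM, ← map_add]; congr 2; ext a; simp

lemma raisedM_smul_left (x : M) (r : ℝ) (b c : TangentSpace 𝓘(ℝ, E) x) :
    Q.raisedM x (r • b) c = r • Q.raisedM x b c := by
  simp only [raisedM, ← map_smul]; congr 2; ext a; simp

lemma raisedM_add_right (x : M) (b c c' : TangentSpace 𝓘(ℝ, E) x) :
    Q.raisedM x b (c + c') = Q.raisedM x b c + Q.raisedM x b c' := by
  simp only [raisedM, ← map_add]

lemma raisedM_smul_right (x : M) (r : ℝ) (b c : TangentSpace 𝓘(ℝ, E) x) :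
    Q.raisedM x b (r • c) = r • Q.raisedM x b c := by
  simp only [raisedM, ← map_smul]

/-- `L^a_bc = (E_b P^a_c + E_c P^a_b) / (2 tr P) + (W_b Π^a_c + W_c Π^a_b) / (2 (N - tr P))
+ (P^a_d - Π^a_d) M^d_bc / 2`, where `N` is the dimension of the manifold. -/
def tensorL (x : M) : TangentSpace 𝓘(ℝ, E) x →ₗ[ℝ] TangentSpace 𝓘(ℝ, E) x →ₗ[ℝ]
    TangentSpace 𝓘(ℝ, E) x :=
  LinearMap.mk₂ ℝ
    (fun b c =>
      (1 / (2 * LinearMap.trace ℝ _ (Q.projP x))) •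
          (Q.covectorE x b • Q.projP x c + Q.covectorE x c • Q.projP x b)
        + (1 / (2 * ((Module.finrank ℝ E : ℝ) - LinearMap.trace ℝ _ (Q.projP x)))) •
          (Q.covectorW x b • Q.projPi x c + Q.covectorW x c • Q.projPi x b)
        + (1 / 2 : ℝ) • (Q.projP x (Q.raisedM x b c) - Q.projPi x (Q.raisedM x b c)))
    (fun b b' c => by simp only [raisedM_add_left, map_add]; module)
    (fun r b c => by simp only [raisedM_smul_left, map_smul, smul_eq_mul]; module)
    (fun b c c' => by simp only [raisedM_add_right, map_add]; module)
    (fun r b c => by simp only [raisedM_smul_right, map_smul, smul_eq_mul]; module)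

/-- The bi-conformal connection: the linear connection whose difference with the Levi-Civita
connection is `L`, that is `(∇_X Y)^a + L^a_bc X^b Y^c`. -/
def biconformal : CovariantDerivative 𝓘(ℝ, E) E (TangentSpace 𝓘(ℝ, E) : M → Type _) :=
  g.leviCivita.addOneForm fun x => (Q.tensorL x).flip.toContinuousBilinearMap

/-- The curvature of the bi-conformal connection with all four indices projected by `Π`:
`Π^d_r Π^s_a Π^t_b Π^q_c R_stq^r`. -/
def projCurvature (x : M) (u v w : TangentSpace 𝓘(ℝ, E) x) : TangentSpace 𝓘(ℝ, E) x :=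
  Q.projPi x (curvature Q.biconformal x (Q.projPi x u) (Q.projPi x v) (Q.projPi x w))
end ProjectorPair
end Tensors

/-- A smooth foliation of codimension `p` of the `N`-manifold `M`: a partition of `M` into embedded
submanifolds of dimension `N - p`, labelled by points of a subset of `ℝ^p`, whose tangent spaces
form a smooth distribution. -/
structure Foliation (N p : ℕ) (M : Type*) [TopologicalSpace M]
    [ChartedSpace (EuclideanSpace ℝ (Fin N)) M] [IsManifold (𝓡 N) ∞ M] where
  /-- the set of labels of the leaves -/
  index : Set (EuclideanSpace ℝ (Fin p))
  /-- the leaves; as topological spaces they carry the subspace topology -/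
  leaf : index → Set M
  /-- the smooth structure of each leaf -/
  charted (τ : index) : ChartedSpace (EuclideanSpace ℝ (Fin (N - p))) (leaf τ)
  isManifold (τ : index) : IsManifold (𝓡 (N - p)) ∞ (leaf τ)
  isSmoothEmbedding (τ : index) :
    Manifold.IsSmoothEmbedding (𝓡 (N - p)) (𝓡 N) ∞ (Subtype.val : leaf τ → M)
  disjoint (τ τ' : index) (h : τ ≠ τ') : Disjoint (leaf τ) (leaf τ')
  cover : ⋃ τ, leaf τ = Set.univ
  /-- the tangent spaces of the leaves are locally spanned by `N - p` smooth vector fields -/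
  smooth (x : M) : ∃ U ∈ 𝓝 x, ∃ X : Fin (N - p) → Π y : M, TangentSpace (𝓡 N) y,
    (∀ i, ContMDiffOn (𝓡 N) (𝓡 N).tangent ∞
      (fun y => (⟨y, X i y⟩ : TangentBundle (𝓡 N) M)) U) ∧
    ∀ (τ : index) (y : leaf τ), y.1 ∈ U →
      Submodule.span ℝ (Set.range fun i => X i y.1) =
        (mfderiv (𝓡 (N - p)) (𝓡 N) (Subtype.val : leaf τ → M) y).range

namespace Foliation
attribute [instance] Foliation.charted Foliation.isManifold
variable {N p : ℕ} {M : Type*} [TopologicalSpace M]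
    [ChartedSpace (EuclideanSpace ℝ (Fin N)) M] [IsManifold (𝓡 N) ∞ M] (F : Foliation N p M)
   (g : PseudoRiemannianMetric (EuclideanSpace ℝ (Fin N)) M)

/-- The tangent space of a leaf, as a subspace of the tangent space of `M`. -/
def leafTangent (τ : F.index) (y : F.leaf τ) : Submodule ℝ (TangentSpace (𝓡 N) (y : M)) :=
  (mfderiv (𝓡 (N - p)) (𝓡 N) (Subtype.val : F.leaf τ → M) y).range

/-- The foliation is non-degenerate if the induced bilinear form on each leaf is. -/
def IsNondegenerate : Prop :=
  ∀ (τ : F.index) (y : F.leaf τ) (u : TangentSpace (𝓡 (N - p)) y),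
    (∀ v, g.form y (mfderiv (𝓡 (N - p)) (𝓡 N) (Subtype.val : F.leaf τ → M) y u)
      (mfderiv (𝓡 (N - p)) (𝓡 N) (Subtype.val : F.leaf τ → M) y v) = 0) → u = 0

/-- The induced metric (first fundamental form) of a leaf. -/
def inducedMetric (hF : F.IsNondegenerate g) (τ : F.index) :
    PseudoRiemannianMetric (EuclideanSpace ℝ (Fin (N - p))) (F.leaf τ) :=
  g.pullback (Subtype.val : F.leaf τ → M) (F.isSmoothEmbedding τ).contMDiff (hF τ)

end Foliation

/-- The pair `(P, Π)` is the one associated to the foliation: `D(Π) = Π(TM)` is the distribution of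
tangent spaces of the leaves. -/
def ProjectorPair.IsAssociatedTo {N p : ℕ} {M : Type*} [TopologicalSpace M]
    [ChartedSpace (EuclideanSpace ℝ (Fin N)) M] [IsManifold (𝓡 N) ∞ M]
   {g : PseudoRiemannianMetric (EuclideanSpace ℝ (Fin N)) M} (Q : ProjectorPair g) (F : Foliation N p M) : Prop :=
  ∀ (τ : F.index) (y : F.leaf τ), LinearMap.range (Q.projPi y) = F.leafTangent τ y


end

end BiConformal

open BiConformal

/-!
The bi-conformal connection `∇̄` induces on each leaf of the foliation the Levi-Civita connection of
the leaf, so the projected curvature of `∇̄` is the curvature tensor of the leaves.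

To see this, let `X`, `Y` be fields tangent to the leaves. Since `P(Y, ·) = 0`, the components of
`M` with all three slots tangent vanish (`tensorM_projPi`), and therefore so do the tangent part of
`M(X, Y)` and the values of `W` on tangent vectors (`covectorW_projPi`). The normal part of
`M(X, Y)` is minus the normal part of `∇_X Y + ∇_Y X` (`projP_raisedM`), hence minus twice the
normal part of `∇_X Y`, as `[X, Y]` is tangent. All other terms of `L(X, Y)` contain `P X` or `P Y`,
so that
`∇̄_X Y = Π (∇_X Y)` (`biconformal_of_tangent`), and comparing Koszul's formula on the manifold and
on the leaf identifies this with the Levi-Civita derivative on the leaf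
(`mfderiv_leviCivita_leafPart`). That derivative is again a tangent field, so it can be
differentiated once more, which gives equality of the curvatures (`mfderiv_curvature_pullback`).
The theorem follows because the derivative of the inclusion of a leaf is injective with image
`Π(TM)`.

Three general facts are needed. Brackets of related vector fields are related
(`mfderiv_mlieBracket_of_related`), since the bracket acts on functions as the commutator
(`mvfderiv_mlieBracket`). The curvature of a smooth connection is tensorial, so that it may be
computed with tangent fields (`curvature_eq_curvatureField`). The bi-conformal connection is smooth
(`isSmoothConnection_biconformal`). Vector fields on a leaf are obtained from fields on the manifold
by `leafPart`, which is defined through the induced metric and therefore smooth.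
-/

namespace BiConformal

set_option linter.unusedSectionVars false

/-! ### Lie brackets as commutators, and related vector fields -/

section Commutator

lemma fderiv_lieBracket_apply {E : Type*} [NormedAddCommGroup E] [NormedSpace ℝ E]
    {G : Type*} [NormedAddCommGroup G] [NormedSpace ℝ G] {h : E → G} {X Y : E → E} {z : E}
    (hh : ContDiffAt ℝ 2 h z) (hX : DifferentiableAt ℝ X z) (hY : DifferentiableAt ℝ Y z) :
    fderiv ℝ h z (lieBracket ℝ X Y z) =
      fderiv ℝ (fun y => fderiv ℝ h y (Y y)) z (X z)
        - fderiv ℝ (fun y => fderiv ℝ h y (X y)) z (Y z) := by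
  have hd : DifferentiableAt ℝ (fderiv ℝ h) z :=
    (hh.fderiv_right (m := 1) (by norm_num)).differentiableAt (by simp)
  have hs := (hh.isSymmSndFDerivAt (by simp)) (X z) (Y z)
  rw [fderiv_clm_apply hd hY, fderiv_clm_apply hd hX]
  simp [lieBracket, hs]

variable {E : Type*} [NormedAddCommGroup E] [NormedSpace ℝ E] [FiniteDimensional ℝ E]
  {M : Type*} [TopologicalSpace M] [ChartedSpace E M] [IsManifold 𝓘(ℝ, E) ∞ M]
  {G : Type*} [NormedAddCommGroup G] [NormedSpace ℝ G]

/-- The derivative of a chart, applied to a field, is the coordinate expression of the field. -/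
lemma mfderiv_extChartAt_apply (X : Π x : M, TangentSpace 𝓘(ℝ, E) x) {x y : M}
    (hy : y ∈ (extChartAt 𝓘(ℝ, E) x).source) :
    mfderiv 𝓘(ℝ, E) 𝓘(ℝ, E) (extChartAt 𝓘(ℝ, E) x) y (X y) =
      mpullbackWithin 𝓘(ℝ, E) 𝓘(ℝ, E) (extChartAt 𝓘(ℝ, E) x).symm X (Set.range 𝓘(ℝ, E))
        (extChartAt 𝓘(ℝ, E) x y) := by
  have : IsManifold 𝓘(ℝ, E) 1 M := .of_le (n := ∞) (by simp)
  obtain ⟨z, hz, rfl⟩ : ∃ z ∈ (extChartAt 𝓘(ℝ, E) x).target, (extChartAt 𝓘(ℝ, E) x).symm z = y :=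
    ⟨_, (extChartAt 𝓘(ℝ, E) x).map_source hy, (extChartAt 𝓘(ℝ, E) x).left_inv hy⟩
  rw [(extChartAt 𝓘(ℝ, E) x).right_inv hz, mpullbackWithin_apply, eq_comm,
    (isInvertible_mfderivWithin_extChartAt_symm hz).inverse_apply_eq]
  have h := mfderivWithin_extChartAt_symm_comp_mfderiv_extChartAt (I := 𝓘(ℝ, E)) hz
  exact (congr($h (X ((extChartAt 𝓘(ℝ, E) x).symm z)))).symm

/-- A vector field acts on functions through its coordinate expression. -/
lemma mvfderiv_apply_eq_fderiv {h : M → G} (X : Π x : M, TangentSpace 𝓘(ℝ, E) x) {x y : M}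
    (hy : y ∈ (extChartAt 𝓘(ℝ, E) x).source) (hh : MDiffAt h y) :
    d% h y (X y) = fderiv ℝ (h ∘ (extChartAt 𝓘(ℝ, E) x).symm) (extChartAt 𝓘(ℝ, E) x y)
      (mpullbackWithin 𝓘(ℝ, E) 𝓘(ℝ, E) (extChartAt 𝓘(ℝ, E) x).symm X (Set.range 𝓘(ℝ, E))
        (extChartAt 𝓘(ℝ, E) x y)) := by
  have : IsManifold 𝓘(ℝ, E) 1 M := .of_le (n := ∞) (by simp)
  have hz := (extChartAt 𝓘(ℝ, E) x).map_source hy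
  rw [← mfderiv_extChartAt_apply X hy, ← mfderiv_eq_fderiv]
  have hs : MDifferentiableAt 𝓘(ℝ, E) 𝓘(ℝ, E) (extChartAt 𝓘(ℝ, E) x).symm
      (extChartAt 𝓘(ℝ, E) x y) := by
    rw [← mdifferentiableWithinAt_univ]
    simpa only [modelWithCornersSelf_coe, Set.range_id] using
      mdifferentiableWithinAt_extChartAt_symm (I := 𝓘(ℝ, E)) hz
  have hφ : MDifferentiableAt 𝓘(ℝ, E) 𝓘(ℝ, E) (extChartAt 𝓘(ℝ, E) x) y :=
    mdifferentiableAt_extChartAt (by simpa using hy)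
  have hh' : MDifferentiableAt 𝓘(ℝ, E) 𝓘(ℝ, G) (h ∘ (extChartAt 𝓘(ℝ, E) x).symm)
      (extChartAt 𝓘(ℝ, E) x y) :=
    MDifferentiableAt.comp (I' := 𝓘(ℝ, E)) _ (by rwa [(extChartAt 𝓘(ℝ, E) x).left_inv hy]) hs
  have key := mfderiv_comp (I' := 𝓘(ℝ, E)) y hh' hφ
  have heq : (h ∘ (extChartAt 𝓘(ℝ, E) x).symm) ∘ (extChartAt 𝓘(ℝ, E) x) =ᶠ[𝓝 y] h := by
    filter_upwards [(isOpen_extChartAt_source x).mem_nhds hy] with y' hy'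
    simp only [Function.comp_apply, (extChartAt 𝓘(ℝ, E) x).left_inv hy']
  rw [heq.mfderiv_eq] at key
  exact congr($key (X y))

/-- The Lie bracket of vector fields is their commutator as derivations on functions. -/
lemma mvfderiv_mlieBracket {h : M → G} {X Y : Π x : M, TangentSpace 𝓘(ℝ, E) x} {x : M}
    (hh : CMDiffAt 2 h x) (hX : MDiffAt (T% X) x) (hY : MDiffAt (T% Y) x) :
    d% h x (mlieBracket 𝓘(ℝ, E) X Y x) =
      d% (fun y => d% h y (Y y)) x (X x) - d% (fun y => d% h y (X y)) x (Y x) := by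
  have : IsManifold 𝓘(ℝ, E) 1 M := .of_le (n := ∞) (by simp)
  have i2 : IsManifold 𝓘(ℝ, E) 2 M := .of_le (n := ∞) (by norm_cast)
  have hx := mem_extChartAt_source (I := 𝓘(ℝ, E)) x
  set φ := extChartAt 𝓘(ℝ, E) x with hφ
  have hs : ContMDiffAt 𝓘(ℝ, E) 𝓘(ℝ, E) ∞ φ.symm (φ x) := by
    rw [← contMDiffWithinAt_univ]
    simpa only [modelWithCornersSelf_coe, Set.range_id] using
      contMDiffWithinAt_extChartAt_symm_range_self (I := 𝓘(ℝ, E)) (n := ∞) x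
  have hh' : ContDiffAt ℝ 2 (h ∘ φ.symm) (φ x) := by
    rw [← contMDiffAt_iff_contDiffAt]
    exact ContMDiffAt.comp (I' := 𝓘(ℝ, E)) _ (by rwa [φ.left_inv hx]) (hs.of_le (by norm_cast))
  have hdiff {Z : Π x : M, TangentSpace 𝓘(ℝ, E) x} (hZ : MDiffAt (T% Z) x) : DifferentiableAt ℝ
      (mpullbackWithin 𝓘(ℝ, E) 𝓘(ℝ, E) φ.symm Z (Set.range 𝓘(ℝ, E))) (φ x) := by
    rw [← mdifferentiableWithinAt_univ] at hZ
    have := hZ.differentiableWithinAt_mpullbackWithin_vectorField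
    rw [modelWithCornersSelf_coe, Set.range_id, Set.preimage_univ, Set.inter_univ] at this
    rw [modelWithCornersSelf_coe, Set.range_id]
    exact differentiableWithinAt_univ.1 this
  have hev : ∀ᶠ y in 𝓝 x, MDiffAt h y := by
    filter_upwards [(contMDiffAt_iff_contMDiffAt_nhds (by simp)).1 hh] with y hy
    exact hy.mdifferentiableAt (by simp)
  have hloc (Z W : Π x : M, TangentSpace 𝓘(ℝ, E) x) (hZ : MDiffAt (T% Z) x) :
      d% (fun y => d% h y (Z y)) x (W x) = fderiv ℝ (fun z => fderiv ℝ (h ∘ φ.symm) z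
        (mpullbackWithin 𝓘(ℝ, E) 𝓘(ℝ, E) φ.symm Z (Set.range 𝓘(ℝ, E)) z)) (φ x)
        (mpullbackWithin 𝓘(ℝ, E) 𝓘(ℝ, E) φ.symm W (Set.range 𝓘(ℝ, E)) (φ x)) := by
    set Q := fun z => fderiv ℝ (h ∘ φ.symm) z
        (mpullbackWithin 𝓘(ℝ, E) 𝓘(ℝ, E) φ.symm Z (Set.range 𝓘(ℝ, E)) z) with hQ
    have hQd : DifferentiableAt ℝ Q (φ x) :=
      ((hh'.fderiv_right (m := 1) (by norm_num)).differentiableAt (by simp)).clm_apply (hdiff hZ)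
    have heq : (fun y => d% h y (Z y)) =ᶠ[𝓝 x] Q ∘ φ := by
      filter_upwards [hev, extChartAt_source_mem_nhds (I := 𝓘(ℝ, E)) x] with y hy hy'
      exact mvfderiv_apply_eq_fderiv Z hy' hy
    have key := mfderiv_comp (I' := 𝓘(ℝ, E)) x
      hQd.mdifferentiableAt (mdifferentiableAt_extChartAt (ChartedSpace.mem_chart_source x))
    rw [← heq.mfderiv_eq, mfderiv_eq_fderiv] at key
    rw [← mfderiv_extChartAt_apply W hx]
    exact congr($key (W x))
  rw [hloc Y X hY, hloc X Y hX, ← fderiv_lieBracket_apply hh' (hdiff hX) (hdiff hY),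
    mvfderiv_apply_eq_fderiv (mlieBracket 𝓘(ℝ, E) X Y) hx hev.self_of_nhds]
  congr 1
  rw [← mfderiv_extChartAt_apply _ hx, ← mlieBracketWithin_univ, mlieBracketWithin_apply]
  refine (ContinuousLinearMap.IsInvertible.self_apply_inverse
    (isInvertible_mfderiv_extChartAt hx) _).trans ?_
  simp only [modelWithCornersSelf_coe, Set.range_id, Set.preimage_univ, Set.inter_univ]
  exact congrFun (lieBracketWithin_univ (𝕜 := ℝ) (E := E)) _

lemma contMDiffAt_mvfderiv_apply {n m : ℕ∞ω} {h : M → G} {X : Π x : M, TangentSpace 𝓘(ℝ, E) x}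
    {x : M} (hh : CMDiffAt n h x) (hX : CMDiffAt m (T% X) x) (hmn : m + 1 ≤ n) :
    CMDiffAt m (fun y => d% h y (X y)) x := by
  have : IsManifold 𝓘(ℝ, E) 1 M := .of_le (n := ∞) (by simp)
  have h1 := hh.mfderiv_const hmn
  have h2 := ContMDiffAt.clm_apply_of_inCoordinates (b₂ := h) h1 hX
    (hh.of_le (le_trans (by simp) hmn))
  exact (contMDiff_snd_tangentBundle_modelSpace G 𝓘(ℝ, G)).contMDiffAt.comp x h2

lemma mdifferentiableAt_mvfderiv_apply {h : M → G} {X : Π x : M, TangentSpace 𝓘(ℝ, E) x}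
    {x : M} (hh : CMDiffAt 2 h x) (hX : MDiffAt (T% X) x) :
    MDiffAt (fun y => d% h y (X y)) x := by
  have : IsManifold 𝓘(ℝ, E) 1 M := .of_le (n := ∞) (by simp)
  have h1 := (hh.mfderiv_const (m := 1) (by norm_num)).mdifferentiableAt (by simp)
  have h2 := MDifferentiableAt.clm_apply_of_inCoordinates (b₂ := h) h1 hX
    (hh.mdifferentiableAt (by simp))
  exact ((contMDiff_snd_tangentBundle_modelSpace G 𝓘(ℝ, G)).contMDiffAt.mdifferentiableAt
    one_ne_zero).comp x h2

variable {E' : Type*} [NormedAddCommGroup E'] [NormedSpace ℝ E'] [FiniteDimensional ℝ E']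
  {L : Type*} [TopologicalSpace L] [ChartedSpace E' L] [IsManifold 𝓘(ℝ, E') ∞ L]

/-- The Lie brackets of `f`-related vector fields are `f`-related. Testing against a chart of the
target reduces this to the description of the bracket as a commutator of derivations. -/
lemma mfderiv_mlieBracket_of_related {f : L → M} {y : L} (hf : CMDiffAt 2 f y)
    {U V : Π y : L, TangentSpace 𝓘(ℝ, E') y} {X Y : Π x : M, TangentSpace 𝓘(ℝ, E) x}
    (hU : MDiffAt (T% U) y) (hV : MDiffAt (T% V) y)
    (hX : MDiffAt (T% X) (f y)) (hY : MDiffAt (T% Y) (f y))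
    (hUX : ∀ᶠ z in 𝓝 y, mfderiv 𝓘(ℝ, E') 𝓘(ℝ, E) f z (U z) = X (f z))
    (hVY : ∀ᶠ z in 𝓝 y, mfderiv 𝓘(ℝ, E') 𝓘(ℝ, E) f z (V z) = Y (f z)) :
    mfderiv 𝓘(ℝ, E') 𝓘(ℝ, E) f y (mlieBracket 𝓘(ℝ, E') U V y) =
      mlieBracket 𝓘(ℝ, E) X Y (f y) := by
  have : IsManifold 𝓘(ℝ, E) 1 M := .of_le (n := ∞) (by simp)
  have : IsManifold 𝓘(ℝ, E') 1 L := .of_le (n := ∞) (by simp)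
  have : IsManifold 𝓘(ℝ, E) 2 M := .of_le (n := ∞) (by norm_cast)
  have : IsManifold 𝓘(ℝ, E') 2 L := .of_le (n := ∞) (by norm_cast)
  set h := extChartAt 𝓘(ℝ, E) (f y)
  have hh : CMDiffAt 2 h (f y) := contMDiffAt_extChartAt
  have hcomp : ∀ᶠ z in 𝓝 y, ∀ v : TangentSpace 𝓘(ℝ, E') z,
      d% (h ∘ f) z v = d% h (f z) (mfderiv 𝓘(ℝ, E') 𝓘(ℝ, E) f z v) := by
    have h1 := hf.continuousAt.eventually ((contMDiffAt_iff_contMDiffAt_nhds (by simp)).1 hh)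
    filter_upwards [(contMDiffAt_iff_contMDiffAt_nhds (by simp)).1 hf, h1] with z hz hz' v
    exact congr($(mfderiv_comp z (hz'.mdifferentiableAt two_ne_zero)
      (hz.mdifferentiableAt two_ne_zero)) v)
  have hloc {W : Π y : L, TangentSpace 𝓘(ℝ, E') y} {Z : Π x : M, TangentSpace 𝓘(ℝ, E) x}
      (hZ : MDiffAt (T% Z) (f y))
      (hWZ : ∀ᶠ z in 𝓝 y, mfderiv 𝓘(ℝ, E') 𝓘(ℝ, E) f z (W z) = Z (f z))
      (v : TangentSpace 𝓘(ℝ, E') y) :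
      d% (fun z => d% (h ∘ f) z (W z)) y v =
        d% (fun x => d% h x (Z x)) (f y) (mfderiv 𝓘(ℝ, E') 𝓘(ℝ, E) f y v) := by
    have heq : (fun z => d% (h ∘ f) z (W z)) =ᶠ[𝓝 y] (fun x => d% h x (Z x)) ∘ f := by
      filter_upwards [hcomp, hWZ] with z hz hz'
      rw [hz, hz', Function.comp_apply]
    have h1 := mfderiv_comp y (mdifferentiableAt_mvfderiv_apply hh hZ)
      (hf.mdifferentiableAt two_ne_zero)
    rw [← heq.mfderiv_eq] at h1
    exact congr($h1 v)
  refine (isInvertible_mfderiv_extChartAt (I := 𝓘(ℝ, E)) (mem_extChartAt_source (f y))).injective ?_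
  have h1 := mvfderiv_mlieBracket hh hX hY
  have h2 := mvfderiv_mlieBracket (hh.comp y hf) hU hV
  rw [hcomp.self_of_nhds, hloc hY hVY, hloc hX hUX, hUX.self_of_nhds, hVY.self_of_nhds, ← h1] at h2
  exact h2

end Commutator

/-! ### Smoothness of tensor fields and connections -/

section Smoothness
variable {E : Type*} [NormedAddCommGroup E] [NormedSpace ℝ E] [FiniteDimensional ℝ E]
  {M : Type*} [TopologicalSpace M] [ChartedSpace E M] [IsManifold 𝓘(ℝ, E) ∞ M]
  {E' : Type*} [NormedAddCommGroup E'] [NormedSpace ℝ E'] [FiniteDimensional ℝ E']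
  {L : Type*} [TopologicalSpace L] [ChartedSpace E' L] [IsManifold 𝓘(ℝ, E') ∞ L]

lemma SmoothBilinearForm.contMDiffAt_form_comp (B : SmoothBilinearForm E M) {f : L → M} {y : L}
    (hf : CMDiffAt ∞ f y) {X Y : Π y : L, TangentSpace 𝓘(ℝ, E) (f y)}
    (hX : CMDiffAt ∞ (fun y => TotalSpace.mk' E (f y) (X y)) y)
    (hY : CMDiffAt ∞ (fun y => TotalSpace.mk' E (f y) (Y y)) y) :
    CMDiffAt ∞ (fun y => B.form (f y) (X y) (Y y)) y := by
  have h : ContMDiffAt 𝓘(ℝ, E') (𝓘(ℝ, E).prod 𝓘(ℝ, ℝ)) ∞ (fun y => TotalSpace.mk' ℝ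
      (E := Bundle.Trivial M ℝ) (f y) (B.form (f y) (X y) (Y y))) y := by
    apply ContMDiffAt.clm_bundle_apply₂ (F₁ := E) (F₂ := E) (b := f)
    · exact B.contMDiff.contMDiffAt.comp y hf
    · exact hX
    · exact hY
  rw [contMDiffAt_totalSpace] at h
  simpa using h.2

lemma SmoothBilinearForm.contMDiffAt_form (B : SmoothBilinearForm E M) {x : M}
    {X Y : Π x : M, TangentSpace 𝓘(ℝ, E) x} (hX : CMDiffAt ∞ (T% X) x)
    (hY : CMDiffAt ∞ (T% Y) x) : CMDiffAt ∞ (fun y => B.form y (X y) (Y y)) x :=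
  B.contMDiffAt_form_comp (f := id) contMDiffAt_id hX hY

/-- In finite dimension, pointwise smoothness of a family of functionals is smoothness in norm. -/
lemma contMDiffAt_clm_of_apply {f : M → E →L[ℝ] ℝ} {x : M}
    (h : ∀ v : E, CMDiffAt ∞ (fun y => f y v) x) : CMDiffAt ∞ f x := by
  let b := Module.finBasis ℝ E
  have : f = fun y => ∑ i, f y (b i) • (LinearMap.toContinuousLinearMap (b.coord i)) := by
    ext y v
    conv_lhs => rw [← b.sum_repr v]
    simp [-Module.Basis.sum_repr, mul_comm]
  rw [this]
  exact contMDiffAt_finsetSum fun i _ => (h (b i)).smul contMDiffAt_const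

lemma isInvertible_of_nondegenerate {A : E →L[ℝ] E →L[ℝ] ℝ}
    (hA : ∀ u, (∀ v, A u v = 0) → u = 0) : A.IsInvertible := by
  let e := LinearMap.linearEquivOfInjective A.toLinearMap
    ((injective_iff_map_eq_zero _).2 fun u hu => hA u fun v => by
      simpa using DFunLike.congr_fun hu v)
    (by
      rw [← LinearMap.toContinuousLinearMap.finrank_eq]
      exact (Subspace.dual_finrank_eq (K := ℝ) (V := E)).symm)
  exact ⟨e.toContinuousLinearEquiv, by ext; rfl⟩

/-- A vector field is smooth as soon as its inner products with all smooth fields are: in a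
trivialization the metric is a smooth family of invertible maps `E → E*`, and inversion of such
maps is smooth. -/
lemma PseudoRiemannianMetric.contMDiffAt_of_form (g : PseudoRiemannianMetric E M) {x : M}
    {X : Π x : M, TangentSpace 𝓘(ℝ, E) x}
    (h : ∀ Z : Π x : M, TangentSpace 𝓘(ℝ, E) x, CMDiffAt ∞ (T% Z) x →
      CMDiffAt ∞ (fun y => g.form y (X y) (Z y)) x) :
    CMDiffAt ∞ (T% X) x := by
  set t := trivializationAt E (TangentSpace 𝓘(ℝ, E)) x with ht
  have hx : x ∈ t.baseSet := FiberBundle.mem_baseSet_trivializationAt' x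
  rw [contMDiffAt_section]
  have hG := g.contMDiff.contMDiffAt (x := x)
  rw [contMDiffAt_hom_bundle] at hG
  obtain ⟨-, hG⟩ := hG
  set G : M → E →L[ℝ] E →L[ℝ] ℝ := fun y => ContinuousLinearMap.inCoordinates E
    (fun x => TangentSpace 𝓘(ℝ, E) x) (E →L[ℝ] ℝ)
    (fun x => TangentSpace 𝓘(ℝ, E) x →L[ℝ] ℝ) x y x y (g.form y) with hGdef
  have hGapp : ∀ y ∈ t.baseSet, ∀ v w : E, G y v w = g.form y (t.symm y v) (t.symm y w) := by
    intro y hy v w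
    simp only [hGdef]
    rw [inCoordinates_apply_eq₂ hy hy (Set.mem_univ _)]
    simp [ht]
  have hinv : ∀ y ∈ t.baseSet, (G y).IsInvertible := by
    refine fun y hy => isInvertible_of_nondegenerate fun v hv => ?_
    have h0 : t.symm y v = 0 := by
      refine g.nondegenerate y _ fun w => ?_
      have := hGapp y hy v (t ⟨y, w⟩).2
      rw [hv, t.symm_apply_apply_mk hy] at this
      exact this.symm
    have h1 := t.apply_mk_symm hy v
    have h2 := t.apply_mk_symm hy 0
    have h3 : t.symm y (0 : E) = 0 :=
      (t.symmₗ_apply (R := ℝ) hy 0).symm.trans (map_zero _)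
    rw [h0] at h1
    rw [h3] at h2
    simpa using congr(($h1).2).symm.trans congr(($h2).2)
  have hφ : CMDiffAt ∞ (fun y => G y (t ⟨y, X y⟩).2) x := by
    refine contMDiffAt_clm_of_apply fun w => ?_
    have hw : CMDiffAt ∞ (T% (fun y => t.symm y w : Π y : M, TangentSpace 𝓘(ℝ, E) y)) x := by
      rw [contMDiffAt_section]
      refine (contMDiffAt_const (c := w)).congr_of_eventuallyEq ?_
      filter_upwards [t.open_baseSet.mem_nhds hx] with y hy
      exact congr(($(t.apply_mk_symm hy w)).2)
    refine (h _ hw).congr_of_eventuallyEq ?_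
    filter_upwards [t.open_baseSet.mem_nhds hx] with y hy
    rw [hGapp y hy, t.symm_apply_apply_mk hy]
  obtain ⟨e, he⟩ := hinv x hx
  have hGinv : CMDiffAt ∞ (fun y => (G y).inverse) x := by
    have h1 := (contDiffAt_map_inverse (n := ∞) e).contMDiffAt
    rw [he] at h1
    exact h1.comp x hG
  refine (hGinv.clm_apply hφ).congr_of_eventuallyEq ?_
  filter_upwards [t.open_baseSet.mem_nhds hx] with y hy
  exact ((hinv y hy).inverse_apply_self _).symm

lemma eventually_mdifferentiableAt {X : Π x : M, TangentSpace 𝓘(ℝ, E) x} {x : M}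
    (hX : CMDiffAt ∞ (T% X) x) : ∀ᶠ y in 𝓝 x, MDiffAt (T% X) y := by
  have : IsManifold 𝓘(ℝ, E) 1 M := .of_le (n := ∞) (by simp)
  have : IsManifold 𝓘(ℝ, E) (1 + 1) M := .of_le (n := ∞) (by norm_cast)
  filter_upwards [(contMDiffAt_iff_contMDiffAt_nhds (by simp)).1
    (hX.of_le (m := 1) (by simp))] with y hy
  exact hy.mdifferentiableAt (by simp)

lemma contMDiffAt_mlieBracket {X Y : Π x : M, TangentSpace 𝓘(ℝ, E) x} {x : M}
    (hX : CMDiffAt ∞ (T% X) x) (hY : CMDiffAt ∞ (T% Y) x) :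
    CMDiffAt ∞ (T% (mlieBracket 𝓘(ℝ, E) X Y)) x := by
  have : IsManifold 𝓘(ℝ, E) (minSmoothness ℝ 2) M := .of_le (n := ∞) (by simp; norm_cast)
  have : IsManifold 𝓘(ℝ, E) (((⊤ : ℕ∞) : ℕ∞ω) + 1) M := ‹IsManifold 𝓘(ℝ, E) ∞ M›
  exact ContMDiffAt.mlieBracket_vectorField (m := ⊤) (n := ⊤) hX hY (by simp)

/-- A linear connection is smooth if `∇_X Y` is smooth at every point at which `X` and `Y` are. -/
def IsSmoothConnection
    (cov : CovariantDerivative 𝓘(ℝ, E) E (TangentSpace 𝓘(ℝ, E) : M → Type _)) : Prop :=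
  ∀ ⦃x : M⦄ ⦃X Y : Π x : M, TangentSpace 𝓘(ℝ, E) x⦄, CMDiffAt ∞ (T% X) x →
    CMDiffAt ∞ (T% Y) x → CMDiffAt ∞ (T% (fun y => cov Y y (X y))) x

/-- By Koszul's formula, the inner products of `∇_X Y` with smooth fields are smooth. -/
lemma PseudoRiemannianMetric.isSmoothConnection_leviCivita (g : PseudoRiemannianMetric E M) :
    IsSmoothConnection g.leviCivita := by
  intro x X Y hX hY
  refine g.contMDiffAt_of_form fun Z hZ => ?_
  have h : CMDiffAt ∞ (fun y => (1 / 2 : ℝ) * g.koszul X Y Z y) x := by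
    refine contMDiffAt_const.mul ?_
    refine ((((ContMDiffAt.add ?_ ?_).sub ?_).add ?_).sub ?_).sub ?_
    · exact contMDiffAt_mvfderiv_apply (g.contMDiffAt_form hY hZ) hX (by simp)
    · exact contMDiffAt_mvfderiv_apply (g.contMDiffAt_form hX hZ) hY (by simp)
    · exact contMDiffAt_mvfderiv_apply (g.contMDiffAt_form hX hY) hZ (by simp)
    · exact g.contMDiffAt_form (contMDiffAt_mlieBracket hX hY) hZ
    · exact g.contMDiffAt_form (contMDiffAt_mlieBracket hX hZ) hY
    · exact g.contMDiffAt_form (contMDiffAt_mlieBracket hY hZ) hX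
  refine h.congr_of_eventuallyEq ?_
  filter_upwards [eventually_mdifferentiableAt hX, eventually_mdifferentiableAt hY,
    eventually_mdifferentiableAt hZ] with y h1 h2 h3
  rw [← g.form_leviCivita h1 h2 h3]
  ring

lemma PseudoRiemannianMetric.contMDiffAt_sharp (g : PseudoRiemannianMetric E M) {x : M}
    {φ : Π x : M, TangentSpace 𝓘(ℝ, E) x →L[ℝ] ℝ}
    (h : ∀ Z : Π x : M, TangentSpace 𝓘(ℝ, E) x, CMDiffAt ∞ (T% Z) x →
      CMDiffAt ∞ (fun y => φ y (Z y)) x) :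
    CMDiffAt ∞ (T% (fun y => g.sharp y (φ y))) x := by
  refine g.contMDiffAt_of_form fun Z hZ => ?_
  simpa only [g.form_sharp] using h Z hZ

lemma PseudoRiemannianMetric.contMDiffAt_raise (g : PseudoRiemannianMetric E M)
    (B : SmoothBilinearForm E M) {x : M} {X : Π x : M, TangentSpace 𝓘(ℝ, E) x}
    (hX : CMDiffAt ∞ (T% X) x) : CMDiffAt ∞ (T% (fun y => g.raise B y (X y))) x :=
  g.contMDiffAt_sharp (φ := fun y => B.form y (X y)) fun _ hZ => B.contMDiffAt_form hX hZ

lemma SmoothBilinearForm.covDeriv_apply (B : SmoothBilinearForm E M)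
    (cov : CovariantDerivative 𝓘(ℝ, E) E (TangentSpace 𝓘(ℝ, E) : M → Type _)) {x : M}
    {Y Z : Π x : M, TangentSpace 𝓘(ℝ, E) x} (hY : MDiffAt (T% Y) x) (hZ : MDiffAt (T% Z) x)
    (u : TangentSpace 𝓘(ℝ, E) x) :
    B.covDeriv cov x (Y x) (Z x) u = d% (fun y => B.form y (Y y) (Z y)) x u
      - B.form x (Z x) (cov Y x u) - B.form x (Y x) (cov Z x u) := by
  have h := TensorialAt.mkHom₂_apply (Φ := fun Y Z => B.covDerivAux cov Y Z x)
    (fun _ hZ => B.covDerivAux_tensorial_left cov hZ)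
    (fun _ hY => B.covDerivAux_tensorial_right cov hY) hY hZ
  exact congr($h u)

lemma SmoothBilinearForm.contMDiffAt_covDeriv (B : SmoothBilinearForm E M)
    {cov : CovariantDerivative 𝓘(ℝ, E) E (TangentSpace 𝓘(ℝ, E) : M → Type _)}
    (hcov : IsSmoothConnection cov) {x : M} {X Y Z : Π x : M, TangentSpace 𝓘(ℝ, E) x}
    (hX : CMDiffAt ∞ (T% X) x) (hY : CMDiffAt ∞ (T% Y) x) (hZ : CMDiffAt ∞ (T% Z) x) :
    CMDiffAt ∞ (fun y => B.covDeriv cov y (Y y) (Z y) (X y)) x := by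
  refine ContMDiffAt.congr_of_eventuallyEq (((contMDiffAt_mvfderiv_apply
    (B.contMDiffAt_form hY hZ) hX (by simp)).sub (B.contMDiffAt_form hZ (hcov hX hY))).sub
    (B.contMDiffAt_form hY (hcov hX hZ))) ?_
  filter_upwards [eventually_mdifferentiableAt hY, eventually_mdifferentiableAt hZ] with y h1 h2
  exact B.covDeriv_apply cov h1 h2 _

lemma contMDiffAt_trace {x : M} {T : Π x : M, TangentSpace 𝓘(ℝ, E) x →ₗ[ℝ] TangentSpace 𝓘(ℝ, E) x}
    (h : ∀ Z : Π x : M, TangentSpace 𝓘(ℝ, E) x, CMDiffAt ∞ (T% Z) x →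
      CMDiffAt ∞ (T% (fun y => T y (Z y))) x) :
    CMDiffAt ∞ (fun y => LinearMap.trace ℝ (TangentSpace 𝓘(ℝ, E) y) (T y)) x := by
  classical
  have : ContMDiffVectorBundle 1 E (TangentSpace 𝓘(ℝ, E) : M → Type _) 𝓘(ℝ, E) :=
    .of_le (n := ∞) (by simp)
  let t := trivializationAt E (TangentSpace 𝓘(ℝ, E)) x
  let b := Module.finBasis ℝ E
  have hx : x ∈ t.baseSet := FiberBundle.mem_baseSet_trivializationAt' x
  have hsum : CMDiffAt ∞ (fun y => ∑ i, t.localFrameCoeff 𝓘(ℝ, E) b i y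
      (T y (t.localFrame b i y))) x :=
    contMDiffAt_finsetSum fun i _ => contMDiffAt_localFrameCoeff b hx
      (h _ (contMDiffAt_localFrame_of_mem ∞ _ b i hx)) i
  refine hsum.congr_of_eventuallyEq ?_
  filter_upwards [t.open_baseSet.mem_nhds hx] with y hy
  rw [LinearMap.trace_eq_matrix_trace ℝ (t.basisAt b hy), Matrix.trace]
  refine Finset.sum_congr rfl fun i _ => ?_
  rw [Matrix.diag_apply, LinearMap.toMatrix_apply, ← t.localFrame_apply_of_mem_baseSet b hy]
  exact (t.localFrameCoeff_apply_of_mem_baseSet b hy (fun y => T y (t.localFrame b i y)) i).symm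

end Smoothness

/-! ### Smoothness of the bi-conformal connection -/

namespace ProjectorPair
variable {E : Type*} [NormedAddCommGroup E] [NormedSpace ℝ E] [FiniteDimensional ℝ E]
  {M : Type*} [TopologicalSpace M] [ChartedSpace E M] [IsManifold 𝓘(ℝ, E) ∞ M]
  {g : PseudoRiemannianMetric E M} (Q : ProjectorPair g) {x : M}

lemma form_projP (u v : TangentSpace 𝓘(ℝ, E) x) : g.form x (Q.projP x u) v = Q.P.form x u v :=
  g.form_sharp x _ v

lemma form_projPi (u v : TangentSpace 𝓘(ℝ, E) x) : g.form x (Q.projPi x u) v = Q.Pi.form x u v :=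
  g.form_sharp x _ v

lemma form_projP' (u v : TangentSpace 𝓘(ℝ, E) x) : g.form x u (Q.projP x v) = Q.P.form x u v := by
  rw [g.symm, form_projP, Q.P.symm]

lemma form_projPi' (u v : TangentSpace 𝓘(ℝ, E) x) :
    g.form x u (Q.projPi x v) = Q.Pi.form x u v := by
  rw [g.symm, form_projPi, Q.Pi.symm]

lemma projP_projP (v : TangentSpace 𝓘(ℝ, E) x) : Q.projP x (Q.projP x v) = Q.projP x v :=
  g.ext_form fun w => by
    rw [form_projP, form_projP, Q.P.symm, Q.P.symm _ v]; exact Q.P_P x w v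

lemma projPi_projPi (v : TangentSpace 𝓘(ℝ, E) x) : Q.projPi x (Q.projPi x v) = Q.projPi x v :=
  g.ext_form fun w => by
    rw [form_projPi, form_projPi, Q.Pi.symm, Q.Pi.symm _ v]; exact Q.Pi_Pi x w v

lemma P_projPi (u v : TangentSpace 𝓘(ℝ, E) x) : Q.P.form x u (Q.projPi x v) = 0 := Q.P_Pi x u v

lemma projP_projPi (v : TangentSpace 𝓘(ℝ, E) x) : Q.projP x (Q.projPi x v) = 0 :=
  g.ext_form fun w => by
    rw [form_projP, Q.P.symm, P_projPi]; simp

lemma projP_add_projPi (v : TangentSpace 𝓘(ℝ, E) x) : Q.projP x v + Q.projPi x v = v :=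
  g.ext_form fun w => by
    rw [map_add, add_apply, form_projP, form_projPi, Q.P_add_Pi]

section Smooth

lemma contMDiffAt_projP {X : Π x : M, TangentSpace 𝓘(ℝ, E) x} (hX : CMDiffAt ∞ (T% X) x) :
    CMDiffAt ∞ (T% (fun y => Q.projP y (X y))) x := g.contMDiffAt_raise Q.P hX

lemma contMDiffAt_projPi {X : Π x : M, TangentSpace 𝓘(ℝ, E) x} (hX : CMDiffAt ∞ (T% X) x) :
    CMDiffAt ∞ (T% (fun y => Q.projPi y (X y))) x := g.contMDiffAt_raise Q.Pi hX

lemma tensorM_apply (a b c : TangentSpace 𝓘(ℝ, E) x) : Q.tensorM x a b c =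
    Q.P.covDeriv g.leviCivita x a c b + Q.P.covDeriv g.leviCivita x a b c
      - Q.P.covDeriv g.leviCivita x b c a := rfl

lemma form_raisedM (a b c : TangentSpace 𝓘(ℝ, E) x) :
    g.form x (Q.raisedM x b c) a = Q.tensorM x a b c := g.form_sharp x _ a

variable {X Y Z : Π x : M, TangentSpace 𝓘(ℝ, E) x}

lemma contMDiffAt_tensorM (hX : CMDiffAt ∞ (T% X) x) (hY : CMDiffAt ∞ (T% Y) x)
    (hZ : CMDiffAt ∞ (T% Z) x) : CMDiffAt ∞ (fun y => Q.tensorM y (X y) (Y y) (Z y)) x := by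
  have h := g.isSmoothConnection_leviCivita
  exact ((Q.P.contMDiffAt_covDeriv h hY hX hZ).add (Q.P.contMDiffAt_covDeriv h hZ hX hY)).sub
    (Q.P.contMDiffAt_covDeriv h hX hY hZ)

lemma contMDiffAt_raisedM (hX : CMDiffAt ∞ (T% X) x) (hY : CMDiffAt ∞ (T% Y) x) :
    CMDiffAt ∞ (T% (fun y => Q.raisedM y (X y) (Y y))) x :=
  g.contMDiffAt_of_form fun _ hZ => by
    simpa only [form_raisedM] using Q.contMDiffAt_tensorM hZ hX hY

lemma contMDiffAt_sharp_tensorM (hX : CMDiffAt ∞ (T% X) x) (hY : CMDiffAt ∞ (T% Y) x) :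
    CMDiffAt ∞ (T% (fun y => g.sharp y
      (LinearMap.toContinuousLinearMap (Q.tensorM y (X y) (Y y))))) x :=
  g.contMDiffAt_sharp (φ := fun y => LinearMap.toContinuousLinearMap (Q.tensorM y (X y) (Y y)))
    fun _ hZ => Q.contMDiffAt_tensorM hX hY hZ

lemma contMDiffAt_covectorE (hX : CMDiffAt ∞ (T% X) x) :
    CMDiffAt ∞ (fun y => Q.covectorE y (X y)) x :=
  contMDiffAt_trace (T := fun y => Q.projP y ∘ₗ (g.sharp y).toLinearMap ∘ₗ
    LinearMap.toContinuousLinearMap.toLinearMap ∘ₗ Q.tensorM y (X y))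
    fun _ hZ => Q.contMDiffAt_projP (Q.contMDiffAt_sharp_tensorM hX hZ)

lemma contMDiffAt_covectorW (hX : CMDiffAt ∞ (T% X) x) :
    CMDiffAt ∞ (fun y => Q.covectorW y (X y)) x :=
  (contMDiffAt_trace (T := fun y => Q.projPi y ∘ₗ (g.sharp y).toLinearMap ∘ₗ
    LinearMap.toContinuousLinearMap.toLinearMap ∘ₗ Q.tensorM y (X y))
    fun _ hZ => Q.contMDiffAt_projPi (Q.contMDiffAt_sharp_tensorM hX hZ)).neg

/-- The trace of `P` is locally constant, being continuous with values in `ℕ` as `P` is idempotent.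
Hence the coefficients `1 / (2 tr P)` and `1 / (2 (N - tr P))` of `L` are smooth even where the
denominator is `0` and the quotient takes its conventional value `0`. -/
lemma trace_projP_eventuallyEq (x : M) :
    ∀ᶠ y in 𝓝 x, LinearMap.trace ℝ _ (Q.projP y) = LinearMap.trace ℝ _ (Q.projP x) := by
  have hnat (y : M) : ∃ n : ℕ, LinearMap.trace ℝ _ (Q.projP y) = n := by
    have : IsIdempotentElem (Q.projP y) := LinearMap.ext fun v => Q.projP_projP v
    exact ⟨_, (LinearMap.IsIdempotentElem.isProj_range _ this).trace⟩
  have hc := (contMDiffAt_trace (T := Q.projP)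
    fun _ hZ => Q.contMDiffAt_projP (x := x) hZ).continuousAt
  filter_upwards [hc.eventually (Metric.eventually_nhds_iff.2 ⟨1, one_pos, fun _ h => h⟩)] with y hy
  obtain ⟨n, hn⟩ := hnat x
  obtain ⟨m, hm⟩ := hnat y
  rw [hn, hm, Real.dist_eq] at hy
  rw [hn, hm]
  have : |(m : ℤ) - n| < 1 := by exact_mod_cast hy
  have := Int.abs_lt_one_iff.1 this
  have : m = n := by omega
  rw [this]

lemma contMDiffAt_tensorL (hX : CMDiffAt ∞ (T% X) x) (hY : CMDiffAt ∞ (T% Y) x) :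
    CMDiffAt ∞ (T% (fun y => Q.tensorL y (X y) (Y y))) x := by
  have hE {X Y : Π x : M, TangentSpace 𝓘(ℝ, E) x} (hX : CMDiffAt ∞ (T% X) x)
      (hY : CMDiffAt ∞ (T% Y) x) :
      CMDiffAt ∞ (T% (fun y => Q.covectorE y (X y) • Q.projP y (Y y))) x :=
    (Q.contMDiffAt_covectorE hX).smul_section (Q.contMDiffAt_projP hY)
  have hW {X Y : Π x : M, TangentSpace 𝓘(ℝ, E) x} (hX : CMDiffAt ∞ (T% X) x)
      (hY : CMDiffAt ∞ (T% Y) x) :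
      CMDiffAt ∞ (T% (fun y => Q.covectorW y (X y) • Q.projPi y (Y y))) x :=
    (Q.contMDiffAt_covectorW hX).smul_section (Q.contMDiffAt_projPi hY)
  have hM := Q.contMDiffAt_raisedM hX hY
  have h := ContMDiffAt.add_section (ContMDiffAt.add_section
    (ContMDiffAt.const_smul_section (a := 1 / (2 * LinearMap.trace ℝ _ (Q.projP x)))
      (ContMDiffAt.add_section (hE hX hY) (hE hY hX)))
    (ContMDiffAt.const_smul_section (a := 1 / (2 * ((Module.finrank ℝ E : ℝ)
      - LinearMap.trace ℝ _ (Q.projP x)))) (ContMDiffAt.add_section (hW hX hY) (hW hY hX))))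
    (ContMDiffAt.const_smul_section (a := (1 / 2 : ℝ))
      (ContMDiffAt.sub_section (Q.contMDiffAt_projP hM) (Q.contMDiffAt_projPi hM)))
  refine h.congr_of_eventuallyEq ?_
  filter_upwards [Q.trace_projP_eventuallyEq x] with y hy
  simp only [tensorL, LinearMap.mk₂_apply, hy]
  rfl

lemma biconformal_apply (u : TangentSpace 𝓘(ℝ, E) x) :
    Q.biconformal X x u = g.leviCivita X x u + Q.tensorL x u (X x) := rfl

lemma isSmoothConnection_biconformal : IsSmoothConnection Q.biconformal := by
  intro x X Y hX hY
  have h := ContMDiffAt.add_section (g.isSmoothConnection_leviCivita hX hY)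
    (Q.contMDiffAt_tensorL hX hY)
  refine h.congr_of_eventuallyEq (.of_forall fun y => ?_)
  dsimp only
  rw [biconformal_apply]
  rfl

end Smooth
end ProjectorPair

/-! ### The bi-conformal connection on tangent fields of the foliation -/

namespace ProjectorPair
variable {E : Type*} [NormedAddCommGroup E] [NormedSpace ℝ E] [FiniteDimensional ℝ E]
  {M : Type*} [TopologicalSpace M] [ChartedSpace E M] [IsManifold 𝓘(ℝ, E) ∞ M]
  {g : PseudoRiemannianMetric E M} (Q : ProjectorPair g) {x : M}

section Tangential
variable {X Y : Π x : M, TangentSpace 𝓘(ℝ, E) x}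

lemma projP_of_projPi_eq {v : TangentSpace 𝓘(ℝ, E) x} (hv : Q.projPi x v = v) :
    Q.projP x v = 0 := by
  rw [← hv, projP_projPi]

lemma P_of_projPi_eq (u : TangentSpace 𝓘(ℝ, E) x) {v : TangentSpace 𝓘(ℝ, E) x}
    (hv : Q.projPi x v = v) : Q.P.form x u v = 0 := by
  rw [← hv, P_projPi]

lemma P_of_projPi_eq' {u : TangentSpace 𝓘(ℝ, E) x} (hu : Q.projPi x u = u)
    (v : TangentSpace 𝓘(ℝ, E) x) : Q.P.form x u v = 0 := by
  rw [Q.P.symm, Q.P_of_projPi_eq v hu]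

/-- Differentiating `P(z, Y) = 0` for a field `Y` tangent to the distribution `Π(TM)`. -/
lemma covDeriv_P_of_tangent (z u : TangentSpace 𝓘(ℝ, E) x) (hY : MDiffAt (T% Y) x)
    (hYt : ∀ᶠ y in 𝓝 x, Q.projPi y (Y y) = Y y) :
    Q.P.covDeriv g.leviCivita x z (Y x) u = -Q.P.form x z (g.leviCivita Y x u) := by
  have h := Q.P.covDeriv_apply g.leviCivita (FiberBundle.mdifferentiableAt_extend 𝓘(ℝ, E) E z) hY u
  have h0 : (fun y => Q.P.form y (FiberBundle.extend E z y) (Y y)) =ᶠ[𝓝 x] fun _ => (0 : ℝ) := by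
    filter_upwards [hYt] with y hy
    exact Q.P_of_projPi_eq _ hy
  have h1 : d% (fun y => Q.P.form y (FiberBundle.extend E z y) (Y y)) x u = 0 := by
    have h2 : d% (fun y => Q.P.form y (FiberBundle.extend E z y) (Y y)) x =
        d% (fun _ : M => (0:ℝ)) x :=
      h0.mfderiv_eq
    rw [h2, mvfderiv_const]
    rfl
  rw [h1, Q.P_of_projPi_eq' hYt.self_of_nhds, FiberBundle.extend_apply_self] at h
  rw [h]
  ring

/-- The components of `∇P` with both tensor slots along `Π(TM)` vanish. -/
lemma covDeriv_P_projPi_projPi (a b u : TangentSpace 𝓘(ℝ, E) x) :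
    Q.P.covDeriv g.leviCivita x (Q.projPi x a) (Q.projPi x b) u = 0 := by
  have hB := (Q.contMDiffAt_projPi
    (FiberBundle.contMDiffAt_extend (k := ∞) 𝓘(ℝ, E) E b)).mdifferentiableAt (by simp)
  have h := Q.covDeriv_P_of_tangent (Q.projPi x a) u hB (.of_forall fun y => Q.projPi_projPi _)
  rw [Q.P_of_projPi_eq' (Q.projPi_projPi a), FiberBundle.extend_apply_self] at h
  rw [h, neg_zero]

lemma tensorM_projPi (a b c : TangentSpace 𝓘(ℝ, E) x) :
    Q.tensorM x (Q.projPi x a) (Q.projPi x b) (Q.projPi x c) = 0 := by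
  simp [tensorM_apply, covDeriv_P_projPi_projPi]

/-- `W` vanishes on `Π(TM)`: its trace only involves the components of `M` along `Π(TM)`. -/
lemma covectorW_projPi (a : TangentSpace 𝓘(ℝ, E) x) : Q.covectorW x (Q.projPi x a) = 0 := by
  set T := (g.sharp x).toLinearMap ∘ₗ LinearMap.toContinuousLinearMap.toLinearMap ∘ₗ
    Q.tensorM x (Q.projPi x a) with hT
  have h1 : Q.projPi x ∘ₗ T = Q.projPi x ∘ₗ (Q.projPi x ∘ₗ T) :=
    LinearMap.ext fun v => (Q.projPi_projPi _).symm
  have h2 : (Q.projPi x ∘ₗ T) ∘ₗ Q.projPi x = 0 := LinearMap.ext fun v => g.ext_form fun w => by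
    have : g.form x (T (Q.projPi x v)) (Q.projPi x w) = 0 :=
      (g.form_sharp x _ _).trans (Q.tensorM_projPi a v w)
    rw [form_projPi'] at this
    simp only [LinearMap.comp_apply, LinearMap.zero_apply, map_zero, zero_apply]
    rw [form_projPi, this]
  change -LinearMap.trace ℝ _ (Q.projPi x ∘ₗ T) = 0
  rw [h1, LinearMap.trace_comp_comm', h2, map_zero, neg_zero]

lemma projPi_raisedM (b c : TangentSpace 𝓘(ℝ, E) x) :
    Q.projPi x (Q.raisedM x (Q.projPi x b) (Q.projPi x c)) = 0 := g.ext_form fun w => by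
  rw [form_projPi, ← form_projPi', form_raisedM, tensorM_projPi]
  simp

/-- The normal part of `M(X, Y)` for tangent fields; it is what makes `L(X, Y)` cancel the second
fundamental form. -/
lemma projP_raisedM (hX : MDiffAt (T% X) x) (hY : MDiffAt (T% Y) x)
    (hXt : ∀ᶠ y in 𝓝 x, Q.projPi y (X y) = X y) (hYt : ∀ᶠ y in 𝓝 x, Q.projPi y (Y y) = Y y) :
    Q.projP x (Q.raisedM x (X x) (Y x)) =
      -Q.projP x (g.leviCivita Y x (X x) + g.leviCivita X x (Y x)) := g.ext_form fun w => by
  have h0 : Q.P.covDeriv g.leviCivita x (X x) (Y x) (Q.projP x w) = 0 := by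
    rw [← hXt.self_of_nhds, ← hYt.self_of_nhds, covDeriv_P_projPi_projPi]
  rw [form_projP, ← form_projP', form_raisedM, tensorM_apply, Q.covDeriv_P_of_tangent _ _ hX hXt,
    Q.covDeriv_P_of_tangent _ _ hY hYt, h0, ← form_projP, ← form_projP, projP_projP,
    form_projP, form_projP, map_neg, neg_apply, form_projP, Q.P.symm, Q.P.symm x w, map_add,
    add_apply]
  ring

/-- On fields tangent to `Π(TM)` with `[X, Y]` again tangent, the bi-conformal connection is the
projection of the Levi-Civita connection. -/
lemma biconformal_of_tangent (hX : MDiffAt (T% X) x) (hY : MDiffAt (T% Y) x)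
    (hXt : ∀ᶠ y in 𝓝 x, Q.projPi y (X y) = X y) (hYt : ∀ᶠ y in 𝓝 x, Q.projPi y (Y y) = Y y)
    (hXY : Q.projP x (mlieBracket 𝓘(ℝ, E) X Y x) = 0) :
    Q.biconformal Y x (X x) = Q.projPi x (g.leviCivita Y x (X x)) := by
  have ht := (CovariantDerivative.torsion_eq_zero_iff (cov := g.leviCivita)).1
    g.leviCivita_torsion hX hY
  rw [← ht, map_sub, sub_eq_zero] at hXY
  have hX0 := hXt.self_of_nhds
  have hY0 := hYt.self_of_nhds
  have hWX : Q.covectorW x (X x) = 0 := by rw [← hX0, covectorW_projPi]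
  have hWY : Q.covectorW x (Y x) = 0 := by rw [← hY0, covectorW_projPi]
  have hPi : Q.projPi x (Q.raisedM x (X x) (Y x)) = 0 := by rw [← hX0, ← hY0, projPi_raisedM]
  have hL : Q.tensorL x (X x) (Y x) = -Q.projP x (g.leviCivita Y x (X x)) := by
    simp only [tensorL, LinearMap.mk₂_apply]
    rw [hWX, hWY, hPi, Q.projP_raisedM hX hY hXt hYt, Q.projP_of_projPi_eq hX0,
      Q.projP_of_projPi_eq hY0, map_add, ← hXY]
    module
  rw [biconformal_apply, hL]
  nth_rewrite 1 [← Q.projP_add_projPi (g.leviCivita Y x (X x))]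
  abel

end Tangential
end ProjectorPair

/-! ### Tensoriality of the curvature -/

section Curvature
variable {E : Type*} [NormedAddCommGroup E] [NormedSpace ℝ E] [FiniteDimensional ℝ E]
  {M : Type*} [TopologicalSpace M] [ChartedSpace E M] [IsManifold 𝓘(ℝ, E) ∞ M]

/-- An additive operation on vector fields which is linear over functions smooth at `x`, when
applied to fields smooth at `x`, only depends on the value of the field at `x`. -/
lemma eq_of_eq_of_smooth_tensorial {A : Type*} [AddCommGroup A] [Module ℝ A] {x : M}
    {Φ : (Π x : M, TangentSpace 𝓘(ℝ, E) x) → A}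
    (hadd : ∀ {X Y : Π x : M, TangentSpace 𝓘(ℝ, E) x}, CMDiffAt ∞ (T% X) x → CMDiffAt ∞ (T% Y) x →
      Φ (X + Y) = Φ X + Φ Y)
    (hsmul : ∀ {f : M → ℝ} {X : Π x : M, TangentSpace 𝓘(ℝ, E) x}, CMDiffAt ∞ f x →
      CMDiffAt ∞ (T% X) x → Φ (f • X) = f x • Φ X)
    {X Y : Π x : M, TangentSpace 𝓘(ℝ, E) x} (hX : CMDiffAt ∞ (T% X) x) (hY : CMDiffAt ∞ (T% Y) x)
    (hXY : X x = Y x) : Φ X = Φ Y := by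
  classical
  have : ContMDiffVectorBundle 1 E (TangentSpace 𝓘(ℝ, E) : M → Type _) 𝓘(ℝ, E) :=
    .of_le (n := ∞) (by simp)
  have hloc {X Y : Π x : M, TangentSpace 𝓘(ℝ, E) x} (hX : CMDiffAt ∞ (T% X) x)
      (hY : CMDiffAt ∞ (T% Y) x) (hXY : ∀ᶠ y in 𝓝 x, X y = Y y) : Φ X = Φ Y := by
    -- the indicator function of the set where the two fields agree is smooth at `x`
    let ψ (y : M) : ℝ := if X y = Y y then 1 else 0
    have hψx : ψ x = 1 := by simp [ψ, hXY.self_of_nhds]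
    have hψ : ψ • X = ψ • Y := by
      funext y
      simp only [Pi.smul_apply', ψ]
      split_ifs with h <;> simp [h]
    have hψ' : CMDiffAt ∞ ψ x := (contMDiffAt_const (c := (1 : ℝ))).congr_of_eventuallyEq
      (hXY.mono fun y hy => by simp [ψ, hy])
    have h1 := hsmul hψ' hX
    rw [hψ, hsmul hψ' hY, hψx, one_smul, one_smul] at h1
    exact h1.symm
  let t := trivializationAt E (TangentSpace 𝓘(ℝ, E)) x
  let b := Module.finBasis ℝ E
  have hx : x ∈ t.baseSet := FiberBundle.mem_baseSet_trivializationAt' x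
  have hs (i) : CMDiffAt ∞ (T% (t.localFrame b i)) x := contMDiffAt_localFrame_of_mem ∞ _ b i hx
  have h0 : Φ 0 = 0 := by
    have := hsmul (f := 0) (X := 0) contMDiffAt_const
      (contMDiff_zeroSection ℝ (TangentSpace 𝓘(ℝ, E) : M → Type _)).contMDiffAt
    simpa using this
  have hexp {X : Π x : M, TangentSpace 𝓘(ℝ, E) x} (hX : CMDiffAt ∞ (T% X) x) :
      Φ X = ∑ i, t.localFrameCoeff 𝓘(ℝ, E) b i x (X x) • Φ (t.localFrame b i) := by
    have hc (i) := contMDiffAt_localFrameCoeff b hx hX i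
    have hsum (s : Finset (Fin (Module.finrank ℝ E))) :
        CMDiffAt ∞ (T% (∑ i ∈ s, LinearMap.piApply (t.localFrameCoeff 𝓘(ℝ, E) b i) X •
          t.localFrame b i)) x ∧
        Φ (∑ i ∈ s, LinearMap.piApply (t.localFrameCoeff 𝓘(ℝ, E) b i) X • t.localFrame b i) =
          ∑ i ∈ s, t.localFrameCoeff 𝓘(ℝ, E) b i x (X x) • Φ (t.localFrame b i) := by
      induction s using Finset.induction_on with
      | empty =>
        simp only [Finset.sum_empty]
        exact ⟨(contMDiff_zeroSection ℝ (TangentSpace 𝓘(ℝ, E) : M → Type _)).contMDiffAt, h0⟩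
      | insert a s ha ih =>
        simp only [Finset.sum_insert ha]
        have h1 := ContMDiffAt.smul_section (hc a) (hs a)
        refine ⟨ContMDiffAt.add_section h1 ih.1, ?_⟩
        rw [hadd h1 ih.1, hsmul (hc a) (hs a), ih.2]
        rfl
    rw [← (hsum Finset.univ).2]
    refine hloc hX (hsum _).1 ?_
    filter_upwards [t.eventually_eq_localFrame_sum_coeff_smul b hx (s := X) (I := 𝓘(ℝ, E))]
      with y hy
    rw [Finset.sum_apply]
    exact hy
  rw [hexp hX, hexp hY, hXY]

variable {cov : CovariantDerivative 𝓘(ℝ, E) E (TangentSpace 𝓘(ℝ, E) : M → Type _)}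
  {x : M} {X Y Z X' Y' Z' : Π x : M, TangentSpace 𝓘(ℝ, E) x}

lemma curvatureField_swap : curvatureField cov X Y Z x = -curvatureField cov Y X Z x := by
  simp only [curvatureField]
  rw [mlieBracket_swap_apply (V := Y) (W := X), map_neg]
  abel

lemma curvatureField_congr_left (hcov : IsSmoothConnection cov) (hX : CMDiffAt ∞ (T% X) x)
    (hX' : CMDiffAt ∞ (T% X') x) (hZ : CMDiffAt ∞ (T% Z) x)
    (h : X x = X' x) : curvatureField cov X Y Z x = curvatureField cov X' Y Z x := by
  refine eq_of_eq_of_smooth_tensorial (Φ := fun X => curvatureField cov X Y Z x) ?_ ?_ hX hX' h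
  · intro X X' hX hX'
    have h1 : (fun y => cov Z y ((X + X') y)) =
        (fun y => cov Z y (X y)) + fun y => cov Z y (X' y) := by
      funext y; simp
    simp only [curvatureField]
    rw [h1, cov.isCovariantDerivativeOnUniv.add ((hcov hX hZ).mdifferentiableAt (by simp))
      ((hcov hX' hZ).mdifferentiableAt (by simp)), mlieBracket_add_right
      (hX.mdifferentiableAt (by simp)) (hX'.mdifferentiableAt (by simp))]
    simp only [add_apply, Pi.add_apply, map_add]
    abel
  · intro f X hf hX
    have h1 : (fun y => cov Z y ((f • X) y)) = f • (fun y => cov Z y (X y)) := by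
      funext y; simp
    simp only [curvatureField]
    rw [h1, cov.isCovariantDerivativeOnUniv.leibniz ((hcov hX hZ).mdifferentiableAt (by simp))
      (hf.mdifferentiableAt (by simp)), mlieBracket_smul_right (hf.mdifferentiableAt (by simp))
      (hX.mdifferentiableAt (by simp))]
    simp
    module

/-- Tensoriality in the differentiated field. The terms containing second derivatives of the
factor cancel because the bracket acts as the commutator. -/
lemma curvatureField_congr_right (hcov : IsSmoothConnection cov) (hX : CMDiffAt ∞ (T% X) x)
    (hY : CMDiffAt ∞ (T% Y) x) (hZ : CMDiffAt ∞ (T% Z) x) (hZ' : CMDiffAt ∞ (T% Z') x)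
    (h : Z x = Z' x) : curvatureField cov X Y Z x = curvatureField cov X Y Z' x := by
  have hcongr {S S' : Π x : M, TangentSpace 𝓘(ℝ, E) x} (hS : CMDiffAt ∞ (T% S) x)
      (h : S' =ᶠ[𝓝 x] S) : cov S' x = cov S x := by
    refine cov.isCovariantDerivativeOnUniv.congr_of_eventuallyEq ?_
      (hS.mdifferentiableAt (by simp)) Filter.univ_mem h
    refine (hS.congr_of_eventuallyEq ?_).mdifferentiableAt (by simp)
    filter_upwards [h] with y hy
    rw [hy]
  refine eq_of_eq_of_smooth_tensorial (Φ := fun Z => curvatureField cov X Y Z x) ?_ ?_ hZ hZ' h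
  · intro Z Z' hZ hZ'
    have key {X : Π x : M, TangentSpace 𝓘(ℝ, E) x} (hX : CMDiffAt ∞ (T% X) x) :
        cov (fun y => cov (Z + Z') y (X y)) x =
          cov (fun y => cov Z y (X y)) x + cov (fun y => cov Z' y (X y)) x := by
      have h1 : (fun y => cov (Z + Z') y (X y)) =ᶠ[𝓝 x]
          (fun y => cov Z y (X y)) + fun y => cov Z' y (X y) := by
        filter_upwards [eventually_mdifferentiableAt hZ, eventually_mdifferentiableAt hZ']
          with y hy hy'
        rw [cov.isCovariantDerivativeOnUniv.add hy hy']
        rfl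
      rw [hcongr (ContMDiffAt.add_section (hcov hX hZ) (hcov hX hZ')) h1,
        cov.isCovariantDerivativeOnUniv.add ((hcov hX hZ).mdifferentiableAt (by simp))
        ((hcov hX hZ').mdifferentiableAt (by simp))]
    simp only [curvatureField]
    rw [key hX, key hY, cov.isCovariantDerivativeOnUniv.add
      (hZ.mdifferentiableAt (by simp)) (hZ'.mdifferentiableAt (by simp))]
    simp only [add_apply]
    abel
  · intro f Z hf hZ
    have key {X : Π x : M, TangentSpace 𝓘(ℝ, E) x} (hX : CMDiffAt ∞ (T% X) x) :
        cov (fun y => cov (f • Z) y (X y)) x =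
          f x • cov (fun y => cov Z y (X y)) x + (d% f x).smulRight (cov Z x (X x)) +
          (d% f x (X x) • cov Z x + (d% (fun y => d% f y (X y)) x).smulRight (Z x)) := by
      have h1 : (fun y => cov (f • Z) y (X y)) =ᶠ[𝓝 x]
          f • (fun y => cov Z y (X y)) + (fun y => d% f y (X y)) • Z := by
        filter_upwards [eventually_mdifferentiableAt hZ,
          (contMDiffAt_iff_contMDiffAt_nhds (n := 1) (by simp)).1 (hf.of_le (by simp))]
          with y hy hy'
        rw [cov.isCovariantDerivativeOnUniv.leibniz hy (hy'.mdifferentiableAt (by simp))]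
        rfl
      have hd : CMDiffAt ∞ (fun y => d% f y (X y)) x := contMDiffAt_mvfderiv_apply hf hX (by simp)
      have h2 := ContMDiffAt.smul_section hf (hcov hX hZ)
      have h3 := ContMDiffAt.smul_section hd hZ
      rw [hcongr (ContMDiffAt.add_section h2 h3) h1, cov.isCovariantDerivativeOnUniv.add
        (h2.mdifferentiableAt (by simp)) (h3.mdifferentiableAt (by simp)),
        cov.isCovariantDerivativeOnUniv.leibniz ((hcov hX hZ).mdifferentiableAt (by simp))
        (hf.mdifferentiableAt (by simp)), cov.isCovariantDerivativeOnUniv.leibniz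
        (hZ.mdifferentiableAt (by simp)) (hd.mdifferentiableAt (by simp))]
    have hbr := mvfderiv_mlieBracket (hf.of_le (m := 2) (by norm_cast))
      (hY.mdifferentiableAt (by simp)) (hX.mdifferentiableAt (by simp))
    simp only [curvatureField]
    rw [key hX, key hY, cov.isCovariantDerivativeOnUniv.leibniz (hZ.mdifferentiableAt (by simp))
      (hf.mdifferentiableAt (by simp))]
    simp [hbr]
    module

/-- The curvature tensor of a smooth connection may be computed with arbitrary smooth fields. -/
lemma curvature_eq_curvatureField (hcov : IsSmoothConnection cov) (hX : CMDiffAt ∞ (T% X) x)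
    (hY : CMDiffAt ∞ (T% Y) x) (hZ : CMDiffAt ∞ (T% Z) x) :
    curvature cov x (X x) (Y x) (Z x) = curvatureField cov X Y Z x := by
  have he (v : TangentSpace 𝓘(ℝ, E) x) := FiberBundle.contMDiffAt_extend (k := ∞) 𝓘(ℝ, E) E v
  rw [curvature, curvatureField_congr_left hcov (he _) hX (he _) (by simp), curvatureField_swap,
    curvatureField_congr_left hcov (he _) hY (he _) (by simp), ← curvatureField_swap,
    curvatureField_congr_right hcov hX hY (he _) hZ (by simp)]

end Curvature

/-! ### Restriction to a leaf -/

section Submanifold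
variable {E : Type*} [NormedAddCommGroup E] [NormedSpace ℝ E] [FiniteDimensional ℝ E]
  {M : Type*} [TopologicalSpace M] [ChartedSpace E M] [IsManifold 𝓘(ℝ, E) ∞ M]
  {E' : Type*} [NormedAddCommGroup E'] [NormedSpace ℝ E'] [FiniteDimensional ℝ E']
  {L : Type*} [TopologicalSpace L] [ChartedSpace E' L] [IsManifold 𝓘(ℝ, E') ∞ L]
  {g : PseudoRiemannianMetric E M} (Q : ProjectorPair g) {f : L → M}
  (hf : ContMDiff 𝓘(ℝ, E') 𝓘(ℝ, E) ∞ f)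
  (hnd : ∀ (y : L) (u : TangentSpace 𝓘(ℝ, E') y),
      (∀ v, g.form (f y) (mfderiv 𝓘(ℝ, E') 𝓘(ℝ, E) f y u)
        (mfderiv 𝓘(ℝ, E') 𝓘(ℝ, E) f y v) = 0) → u = 0)
  {X Y Z : Π x : M, TangentSpace 𝓘(ℝ, E) x} {y : L}

/-- The vector field on `L` obtained by projecting a vector field `X` of `M` along `f : L → M`
orthogonally onto the image of the derivative of `f`. -/
noncomputable def leafPart (X : Π x : M, TangentSpace 𝓘(ℝ, E) x) (y : L) :
    TangentSpace 𝓘(ℝ, E') y :=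
  (g.pullback f hf hnd).sharp y ((g.form (f y) (X (f y))).comp (mfderiv 𝓘(ℝ, E') 𝓘(ℝ, E) f y))

include hnd in
lemma mfderiv_injective_of_nondegenerate (y : L) :
    Function.Injective (mfderiv 𝓘(ℝ, E') 𝓘(ℝ, E) f y) :=
  (injective_iff_map_eq_zero _).2 fun u hu => hnd y u fun v => by rw [hu]; simp

lemma contMDiffAt_leafPart (hX : CMDiffAt ∞ (T% X) (f y)) :
    CMDiffAt ∞ (T% (leafPart hf hnd X)) y := by
  have : IsManifold 𝓘(ℝ, E) 1 M := .of_le (n := ∞) (by simp)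
  have : IsManifold 𝓘(ℝ, E') 1 L := .of_le (n := ∞) (by simp)
  refine (g.pullback f hf hnd).contMDiffAt_sharp fun W hW => ?_
  refine g.contMDiffAt_form_comp (hf y) (hX.comp y (hf y)) ?_
  exact ContMDiffAt.clm_apply_of_inCoordinates (b₂ := f) ((hf y).mfderiv_const (m := ∞) (by simp))
    hW (hf y)

variable (hQ : ∀ y : L, LinearMap.range (Q.projPi (f y)) =
  (mfderiv 𝓘(ℝ, E') 𝓘(ℝ, E) f y).range)

include hQ in
/-- A tangent field of the foliation is related to its leaf part. -/
lemma mfderiv_leafPart (hX : Q.projPi (f y) (X (f y)) = X (f y)) :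
    mfderiv 𝓘(ℝ, E') 𝓘(ℝ, E) f y (leafPart hf hnd X y) = X (f y) := by
  obtain ⟨u, hu⟩ : X (f y) ∈ (mfderiv 𝓘(ℝ, E') 𝓘(ℝ, E) f y).range := by
    rw [← hQ]; exact ⟨_, hX⟩
  have hu' : mfderiv 𝓘(ℝ, E') 𝓘(ℝ, E) f y u = X (f y) := hu
  rw [← hu']
  congr 1
  refine (g.pullback f hf hnd).ext_form fun w => ?_
  rw [leafPart, (g.pullback f hf hnd).form_sharp, ← hu']
  rfl

include hQ in
lemma projPi_mfderiv (u : TangentSpace 𝓘(ℝ, E') y) :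
    Q.projPi (f y) (mfderiv 𝓘(ℝ, E') 𝓘(ℝ, E) f y u) = mfderiv 𝓘(ℝ, E') 𝓘(ℝ, E) f y u := by
  obtain ⟨v, hv⟩ : mfderiv 𝓘(ℝ, E') 𝓘(ℝ, E) f y u ∈ LinearMap.range (Q.projPi (f y)) := by
    rw [hQ]; exact ⟨u, rfl⟩
  rw [← hv, Q.projPi_projPi]

include hQ in
lemma eventually_mfderiv_leafPart (hX : ∀ᶠ x in 𝓝 (f y), Q.projPi x (X x) = X x) :
    ∀ᶠ z in 𝓝 y, mfderiv 𝓘(ℝ, E') 𝓘(ℝ, E) f z (leafPart hf hnd X z) = X (f z) :=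
  (hf.continuous.continuousAt.eventually hX).mono fun _ hz => mfderiv_leafPart Q hf hnd hQ hz

include hQ in
lemma mfderiv_mlieBracket_leafPart (hX : CMDiffAt ∞ (T% X) (f y)) (hY : CMDiffAt ∞ (T% Y) (f y))
    (hXt : ∀ᶠ x in 𝓝 (f y), Q.projPi x (X x) = X x)
    (hYt : ∀ᶠ x in 𝓝 (f y), Q.projPi x (Y x) = Y x) :
    mfderiv 𝓘(ℝ, E') 𝓘(ℝ, E) f y
      (mlieBracket 𝓘(ℝ, E') (leafPart hf hnd X) (leafPart hf hnd Y) y) =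
      mlieBracket 𝓘(ℝ, E) X Y (f y) :=
  mfderiv_mlieBracket_of_related ((hf y).of_le (by norm_cast))
    ((contMDiffAt_leafPart hf hnd hX).mdifferentiableAt (by simp))
    ((contMDiffAt_leafPart hf hnd hY).mdifferentiableAt (by simp))
    (hX.mdifferentiableAt (by simp)) (hY.mdifferentiableAt (by simp))
    (eventually_mfderiv_leafPart Q hf hnd hQ hXt) (eventually_mfderiv_leafPart Q hf hnd hQ hYt)

include hQ in
lemma koszul_leafPart (hX : CMDiffAt ∞ (T% X) (f y)) (hY : CMDiffAt ∞ (T% Y) (f y))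
    (hZ : CMDiffAt ∞ (T% Z) (f y)) (hXt : ∀ᶠ x in 𝓝 (f y), Q.projPi x (X x) = X x)
    (hYt : ∀ᶠ x in 𝓝 (f y), Q.projPi x (Y x) = Y x)
    (hZt : ∀ᶠ x in 𝓝 (f y), Q.projPi x (Z x) = Z x) :
    (g.pullback f hf hnd).koszul (leafPart hf hnd X) (leafPart hf hnd Y) (leafPart hf hnd Z) y =
      g.koszul X Y Z (f y) := by
  have hd {X Y Z : Π x : M, TangentSpace 𝓘(ℝ, E) x}
      (hY : CMDiffAt ∞ (T% Y) (f y)) (hZ : CMDiffAt ∞ (T% Z) (f y))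
      (hXt : ∀ᶠ x in 𝓝 (f y), Q.projPi x (X x) = X x)
      (hYt : ∀ᶠ x in 𝓝 (f y), Q.projPi x (Y x) = Y x)
      (hZt : ∀ᶠ x in 𝓝 (f y), Q.projPi x (Z x) = Z x) :
      d% (fun z => (g.pullback f hf hnd).form z (leafPart hf hnd Y z) (leafPart hf hnd Z z)) y
        (leafPart hf hnd X y) = d% (fun x => g.form x (Y x) (Z x)) (f y) (X (f y)) := by
    have heq : (fun z => (g.pullback f hf hnd).form z (leafPart hf hnd Y z) (leafPart hf hnd Z z))
        =ᶠ[𝓝 y] (fun x => g.form x (Y x) (Z x)) ∘ f := by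
      filter_upwards [eventually_mfderiv_leafPart Q hf hnd hQ hYt,
        eventually_mfderiv_leafPart Q hf hnd hQ hZt] with z h1 h2
      rw [Function.comp_apply, ← h1, ← h2]
      rfl
    have h1 := mfderiv_comp y ((g.contMDiffAt_form hY hZ).mdifferentiableAt (by simp))
      ((hf y).mdifferentiableAt (by simp))
    rw [← heq.mfderiv_eq] at h1
    rw [← mfderiv_leafPart Q hf hnd hQ hXt.self_of_nhds]
    exact congr($h1 (leafPart hf hnd X y))
  have hform (u v : TangentSpace 𝓘(ℝ, E') y) : (g.pullback f hf hnd).form y u v =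
    g.form (f y) (mfderiv 𝓘(ℝ, E') 𝓘(ℝ, E) f y u) (mfderiv 𝓘(ℝ, E') 𝓘(ℝ, E) f y v) := rfl
  simp only [PseudoRiemannianMetric.koszul]
  rw [hd hY hZ hXt hYt hZt, hd hX hZ hYt hXt hZt, hd hX hY hZt hXt hYt, hform, hform, hform,
    mfderiv_mlieBracket_leafPart Q hf hnd hQ hX hY hXt hYt,
    mfderiv_mlieBracket_leafPart Q hf hnd hQ hX hZ hXt hZt,
    mfderiv_mlieBracket_leafPart Q hf hnd hQ hY hZ hYt hZt,
    mfderiv_leafPart Q hf hnd hQ hXt.self_of_nhds, mfderiv_leafPart Q hf hnd hQ hYt.self_of_nhds,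
    mfderiv_leafPart Q hf hnd hQ hZt.self_of_nhds]

include hQ in
/-- Gauss' formula, combined with the fact that the bi-conformal connection is the tangential part
of the Levi-Civita connection: the former induces the Levi-Civita connection of the leaf. -/
lemma mfderiv_leviCivita_leafPart (hX : CMDiffAt ∞ (T% X) (f y)) (hY : CMDiffAt ∞ (T% Y) (f y))
    (hXt : ∀ᶠ x in 𝓝 (f y), Q.projPi x (X x) = X x)
    (hYt : ∀ᶠ x in 𝓝 (f y), Q.projPi x (Y x) = Y x) :
    mfderiv 𝓘(ℝ, E') 𝓘(ℝ, E) f y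
      ((g.pullback f hf hnd).leviCivita (leafPart hf hnd Y) y (leafPart hf hnd X y)) =
      Q.biconformal Y (f y) (X (f y)) := by
  have hXd := hX.mdifferentiableAt (by simp : (∞ : ℕ∞ω) ≠ 0)
  have hYd := hY.mdifferentiableAt (by simp : (∞ : ℕ∞ω) ≠ 0)
  rw [Q.biconformal_of_tangent hXd hYd hXt hYt (by
    rw [← mfderiv_mlieBracket_leafPart Q hf hnd hQ hX hY hXt hYt]
    exact Q.projP_of_projPi_eq (projPi_mfderiv Q hQ _))]
  obtain ⟨u, hu⟩ : Q.projPi (f y) (g.leviCivita Y (f y) (X (f y))) ∈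
      (mfderiv 𝓘(ℝ, E') 𝓘(ℝ, E) f y).range := by
    rw [← hQ]; exact ⟨_, rfl⟩
  have hu' : mfderiv 𝓘(ℝ, E') 𝓘(ℝ, E) f y u =
    Q.projPi (f y) (g.leviCivita Y (f y) (X (f y))) := hu
  rw [← hu']
  congr 1
  refine (g.pullback f hf hnd).ext_form fun w => ?_
  set w' := mfderiv 𝓘(ℝ, E') 𝓘(ℝ, E) f y w with hw'
  let Z : Π x : M, TangentSpace 𝓘(ℝ, E) x := fun x => Q.projPi x (FiberBundle.extend E w' x)
  have hZ : CMDiffAt ∞ (T% Z) (f y) :=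
    Q.contMDiffAt_projPi (FiberBundle.contMDiffAt_extend 𝓘(ℝ, E) E w')
  have hZt : ∀ᶠ x in 𝓝 (f y), Q.projPi x (Z x) = Z x := .of_forall fun x => Q.projPi_projPi _
  have hZw : Z (f y) = w' := by
    simp only [Z, FiberBundle.extend_apply_self]
    exact projPi_mfderiv Q hQ w
  have hw : leafPart hf hnd Z y = w := mfderiv_injective_of_nondegenerate hnd y
    ((mfderiv_leafPart Q hf hnd hQ hZt.self_of_nhds).trans hZw)
  have h1 := (g.pullback f hf hnd).form_leviCivita
    ((contMDiffAt_leafPart hf hnd hX).mdifferentiableAt (by simp))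
    ((contMDiffAt_leafPart hf hnd hY).mdifferentiableAt (by simp))
    ((contMDiffAt_leafPart hf hnd hZ).mdifferentiableAt (by simp))
  rw [koszul_leafPart Q hf hnd hQ hX hY hZ hXt hYt hZt,
    ← g.form_leviCivita hXd hYd (hZ.mdifferentiableAt (by simp)), hw, hZw] at h1
  have h2 : (g.pullback f hf hnd).form y u w =
      g.form (f y) (g.leviCivita Y (f y) (X (f y))) w' := by
    change g.form (f y) (mfderiv 𝓘(ℝ, E') 𝓘(ℝ, E) f y u) w' = _
    rw [hu', Q.form_projPi, ← Q.form_projPi', hw', projPi_mfderiv Q hQ]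
  rw [h2]
  exact mul_left_cancel₀ two_ne_zero h1

/-- The distribution `Π(TM)` is involutive: at each point, the bracket of smooth fields which are
tangent to it near the point is tangent to it. -/
def ProjectorPair.IsInvolutive {g : PseudoRiemannianMetric E M} (Q : ProjectorPair g) : Prop :=
  ∀ ⦃x : M⦄ ⦃X Y : Π x : M, TangentSpace 𝓘(ℝ, E) x⦄, CMDiffAt ∞ (T% X) x → CMDiffAt ∞ (T% Y) x →
    (∀ᶠ y in 𝓝 x, Q.projPi y (X y) = X y) → (∀ᶠ y in 𝓝 x, Q.projPi y (Y y) = Y y) →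
    Q.projPi x (mlieBracket 𝓘(ℝ, E) X Y x) = mlieBracket 𝓘(ℝ, E) X Y x

include hQ in
/-- Curvature of tangent fields. Involutivity is needed at the points off the leaf too, as the field
`∇̄_X Z` that is differentiated again has to be tangent to the foliation near `f y`. -/
lemma mfderiv_curvatureField_leafPart (hinv : Q.IsInvolutive)
    (hX : ∀ᶠ x in 𝓝 (f y), CMDiffAt ∞ (T% X) x) (hY : ∀ᶠ x in 𝓝 (f y), CMDiffAt ∞ (T% Y) x)
    (hZ : ∀ᶠ x in 𝓝 (f y), CMDiffAt ∞ (T% Z) x) (hXt : ∀ x, Q.projPi x (X x) = X x)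
    (hYt : ∀ x, Q.projPi x (Y x) = Y x) (hZt : ∀ x, Q.projPi x (Z x) = Z x) :
    mfderiv 𝓘(ℝ, E') 𝓘(ℝ, E) f y (curvatureField (g.pullback f hf hnd).leviCivita
      (leafPart hf hnd X) (leafPart hf hnd Y) (leafPart hf hnd Z) y) =
      curvatureField Q.biconformal X Y Z (f y) := by
  set cov := (g.pullback f hf hnd).leviCivita with hcov
  -- `∇̄_X Z` is again tangent to the leaves, and restricts to the covariant derivative on the leaf
  have key {X Y : Π x : M, TangentSpace 𝓘(ℝ, E) x}
      (hX : ∀ᶠ x in 𝓝 (f y), CMDiffAt ∞ (T% X) x) (hY : ∀ᶠ x in 𝓝 (f y), CMDiffAt ∞ (T% Y) x)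
      (hXt : ∀ x, Q.projPi x (X x) = X x) (hYt : ∀ x, Q.projPi x (Y x) = Y x) :
      mfderiv 𝓘(ℝ, E') 𝓘(ℝ, E) f y
        (cov (fun z => cov (leafPart hf hnd Z) z (leafPart hf hnd X z)) y (leafPart hf hnd Y y)) =
        Q.biconformal (fun x => Q.biconformal Z x (X x)) (f y) (Y (f y)) := by
    set S : Π x : M, TangentSpace 𝓘(ℝ, E) x := fun x => Q.biconformal Z x (X x) with hS
    have hSt : ∀ᶠ x in 𝓝 (f y), Q.projPi x (S x) = S x := by
      filter_upwards [hX, hZ] with x h1 h2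
      have h3 := hinv h1 h2 (.of_forall hXt) (.of_forall hZt)
      simp only [hS]
      rw [Q.biconformal_of_tangent (h1.mdifferentiableAt (by simp))
        (h2.mdifferentiableAt (by simp)) (.of_forall hXt) (.of_forall hZt)
        (Q.projP_of_projPi_eq h3), Q.projPi_projPi]
    have hSs : CMDiffAt ∞ (T% S) (f y) :=
      Q.isSmoothConnection_biconformal hX.self_of_nhds hZ.self_of_nhds
    have heq : ∀ᶠ z in 𝓝 y, cov (leafPart hf hnd Z) z (leafPart hf hnd X z) =
        leafPart hf hnd S z := by
      filter_upwards [hf.continuous.continuousAt.eventually hX,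
        hf.continuous.continuousAt.eventually hZ,
        eventually_mfderiv_leafPart Q hf hnd hQ hSt] with z h1 h2 h3
      refine mfderiv_injective_of_nondegenerate hnd z ?_
      rw [h3]
      exact mfderiv_leviCivita_leafPart Q hf hnd hQ h1 h2 (.of_forall hXt) (.of_forall hZt)
    have h1 := (g.pullback f hf hnd).isSmoothConnection_leviCivita
      (contMDiffAt_leafPart hf hnd hX.self_of_nhds) (contMDiffAt_leafPart hf hnd hZ.self_of_nhds)
    have h2 := contMDiffAt_leafPart hf hnd hSs
    rw [cov.isCovariantDerivativeOnUniv.congr_of_eventuallyEq (h1.mdifferentiableAt (by simp))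
      (h2.mdifferentiableAt (by simp)) Filter.univ_mem heq]
    exact mfderiv_leviCivita_leafPart Q hf hnd hQ hY.self_of_nhds hSs (.of_forall hYt) hSt
  have hbr : mlieBracket 𝓘(ℝ, E') (leafPart hf hnd Y) (leafPart hf hnd X) y =
      leafPart hf hnd (mlieBracket 𝓘(ℝ, E) Y X) y := by
    refine mfderiv_injective_of_nondegenerate hnd y ?_
    rw [mfderiv_mlieBracket_leafPart Q hf hnd hQ hY.self_of_nhds hX.self_of_nhds
      (.of_forall hYt) (.of_forall hXt), mfderiv_leafPart Q hf hnd hQ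
      (hinv hY.self_of_nhds hX.self_of_nhds (.of_forall hYt) (.of_forall hXt))]
  have hbrt : ∀ᶠ x in 𝓝 (f y), Q.projPi x (mlieBracket 𝓘(ℝ, E) Y X x) =
      mlieBracket 𝓘(ℝ, E) Y X x := by
    filter_upwards [hX, hY] with x h1 h2
    exact hinv h2 h1 (.of_forall hYt) (.of_forall hXt)
  simp only [curvatureField]
  rw [map_sub, map_sub, key hX hY hXt hYt, key hY hX hYt hXt, hbr,
    mfderiv_leviCivita_leafPart Q hf hnd hQ
      (contMDiffAt_mlieBracket hY.self_of_nhds hX.self_of_nhds) hZ.self_of_nhds hbrt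
      (.of_forall hZt)]

include hQ in
/-- The curvature of the bi-conformal connection along a leaf is the curvature of the leaf. -/
lemma mfderiv_curvature_pullback (hinv : Q.IsInvolutive) (u v w : TangentSpace 𝓘(ℝ, E') y) :
    mfderiv 𝓘(ℝ, E') 𝓘(ℝ, E) f y (curvature (g.pullback f hf hnd).leviCivita y u v w) =
      curvature Q.biconformal (f y) (mfderiv 𝓘(ℝ, E') 𝓘(ℝ, E) f y u)
        (mfderiv 𝓘(ℝ, E') 𝓘(ℝ, E) f y v) (mfderiv 𝓘(ℝ, E') 𝓘(ℝ, E) f y w) := by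
  let T (u : TangentSpace 𝓘(ℝ, E') y) : Π x : M, TangentSpace 𝓘(ℝ, E) x :=
    fun x => Q.projPi x (FiberBundle.extend E (mfderiv 𝓘(ℝ, E') 𝓘(ℝ, E) f y u) x)
  have hT (u) : ∀ᶠ x in 𝓝 (f y), CMDiffAt ∞ (T% (T u)) x := by
    obtain ⟨s, hs, hs'⟩ := FiberBundle.exists_contMDiffOn_extend (k := ∞) 𝓘(ℝ, E) E
      (mfderiv 𝓘(ℝ, E') 𝓘(ℝ, E) f y u)
    filter_upwards [eventually_mem_nhds_iff.2 hs] with x hx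
    exact Q.contMDiffAt_projPi (hs'.contMDiffAt hx)
  have hTt (u x) : Q.projPi x (T u x) = T u x := Q.projPi_projPi _
  have hTy (u) : T u (f y) = mfderiv 𝓘(ℝ, E') 𝓘(ℝ, E) f y u := by
    simp only [T, FiberBundle.extend_apply_self]
    exact projPi_mfderiv Q hQ u
  have hTl (u) : leafPart hf hnd (T u) y = u := mfderiv_injective_of_nondegenerate hnd y
    ((mfderiv_leafPart Q hf hnd hQ (hTt u _)).trans (hTy u))
  have hs (u) := contMDiffAt_leafPart hf hnd (hT u).self_of_nhds
  have h1 := curvature_eq_curvatureField (g.pullback f hf hnd).isSmoothConnection_leviCivita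
    (hs u) (hs v) (hs w)
  have h2 := curvature_eq_curvatureField Q.isSmoothConnection_biconformal
    (hT u).self_of_nhds (hT v).self_of_nhds (hT w).self_of_nhds
  rw [hTl, hTl, hTl] at h1
  rw [hTy, hTy, hTy] at h2
  rw [h1, h2]
  exact mfderiv_curvatureField_leafPart Q hf hnd hQ hinv (hT u) (hT v) (hT w) (hTt u) (hTt v)
    (hTt w)

end Submanifold

/-- Every point lies on a leaf, and brackets of fields tangent to a leaf are tangent to it. -/
lemma ProjectorPair.IsAssociatedTo.isInvolutive {N p : ℕ} {M : Type*} [TopologicalSpace M]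
    [ChartedSpace (EuclideanSpace ℝ (Fin N)) M] [IsManifold (𝓡 N) ∞ M]
    {g : PseudoRiemannianMetric (EuclideanSpace ℝ (Fin N)) M} {Q : ProjectorPair g}
    {F : Foliation N p M} (hQ : Q.IsAssociatedTo F) (hF : F.IsNondegenerate g) :
    Q.IsInvolutive := by
  intro x X Y hX hY hXt hYt
  obtain ⟨τ, hx⟩ : ∃ τ, x ∈ F.leaf τ := Set.mem_iUnion.1 (F.cover ▸ Set.mem_univ x)
  have h := mfderiv_mlieBracket_leafPart Q (y := (⟨x, hx⟩ : F.leaf τ))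
    (F.isSmoothEmbedding τ).contMDiff (hF τ) (hQ τ) hX hY hXt hYt
  rw [← h]
  exact projPi_mfderiv Q (hQ τ) (y := (⟨x, hx⟩ : F.leaf τ)) _

end BiConformal

theorem mainTheorem2 (N p : ℕ) (hN : 3 < N) (hp : p + 3 ≤ N)
    {M : Type*} [TopologicalSpace M] [ChartedSpace (EuclideanSpace ℝ (Fin N)) M]
    [IsManifold (𝓡 N) ∞ M]
    (g : PseudoRiemannianMetric (EuclideanSpace ℝ (Fin N)) M)
    (F : Foliation N p M) (hF : F.IsNondegenerate g)
    (Q : ProjectorPair g) (hQ : Q.IsAssociatedTo F) :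
    (∀ (x : M) (u v w : TangentSpace (𝓡 N) x), Q.projCurvature x u v w = 0) ↔
      ∀ τ : F.index, (F.inducedMetric g hF τ).IsFlat := by
  have key (τ : F.index) (y : F.leaf τ) := mfderiv_curvature_pullback Q (y := y)
    (F.isSmoothEmbedding τ).contMDiff (hF τ) (hQ τ) (hQ.isInvolutive hF)
  constructor
  · intro h τ y u v w
    refine mfderiv_injective_of_nondegenerate (hF τ) y ?_
    refine Eq.trans ?_ (map_zero _).symm
    have h1 := h y (mfderiv (𝓡 (N - p)) (𝓡 N) Subtype.val y u)
      (mfderiv (𝓡 (N - p)) (𝓡 N) Subtype.val y v) (mfderiv (𝓡 (N - p)) (𝓡 N) Subtype.val y w)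
    rw [ProjectorPair.projCurvature, projPi_mfderiv Q (hQ τ), projPi_mfderiv Q (hQ τ),
      projPi_mfderiv Q (hQ τ), ← key τ y u v w, projPi_mfderiv Q (hQ τ)] at h1
    exact h1
  · intro h x u v w
    obtain ⟨τ, hx⟩ : ∃ τ, x ∈ F.leaf τ := Set.mem_iUnion.1 (F.cover ▸ Set.mem_univ x)
    let y : F.leaf τ := ⟨x, hx⟩
    have hpre (u : TangentSpace (𝓡 N) x) : ∃ a : TangentSpace (𝓡 (N - p)) y,
        mfderiv (𝓡 (N - p)) (𝓡 N) Subtype.val y a = Q.projPi x u := by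
      have : Q.projPi x u ∈ F.leafTangent τ y := by
        rw [← hQ τ y]; exact ⟨u, rfl⟩
      exact this
    obtain ⟨a, ha⟩ := hpre u
    obtain ⟨b, hb⟩ := hpre v
    obtain ⟨c, hc⟩ := hpre w
    have h1 := key τ y a b c
    have h2 : curvature (g.pullback (Subtype.val : F.leaf τ → M)
      (F.isSmoothEmbedding τ).contMDiff (hF τ)).leviCivita y a b c = 0 := h τ y a b c
    rw [h2, map_zero, ha, hb, hc] at h1
    rw [ProjectorPair.projCurvature, ← h1, map_zero]
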